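/- Let $p$ be a prime and let $\Gamma$ be a finite simplicial graph which is chordal, i.e. every circuit of $\Gamma$ with at least four vertices has a chord (an edge of $\Gamma$ that is not part of the circuit but connects two vertices of the circuit). Let $G_\Gamma$ be the right-angled Artin pro-$p$ group associated to $\Gamma$, that is, the pro-$p$ completion of the group generated by the vertices of $\Gamma$ subject to the relations $uv=vu$ for all adjacent vertices $u,v$. Then the commutator subgroup of $G_\Gamma$ (the closed subgroup generated by all commutators) is a free pro-$p$ group. Here a pro-$p$ group $F$ is called free if there are a pointed profinite space $(X,x_0)$ and a continuous map $\iota\colon X\to F$ with $\iota(x_0)=1$ such that for every pro-$p$ group $H$ and every continuous map $f\colon X\to H$ with $f(x_0)=1$ there is a unique continuous homomorphism $\varphi\colon F\to H$ with $\varphi\circ\iota=f$. -/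

import Mathlib

universe u

/-- A finite graph is chordal when every circuit with at least four vertices has a chord: an edge of
the graph that joins two vertices of the circuit and is not one of the edges of the circuit.
(A circuit of a simple graph is a closed walk without repeated vertices or edges,
and its length is its number of vertices.) -/
def SimpleGraph.IsChordalGraph {V : Type u} (Γ : SimpleGraph V) : Prop :=
  ∀ (v : V) (c : Γ.Walk v v), c.IsCycle → 4 ≤ c.length →
    ∃ a b : V, a ∈ c.support ∧ b ∈ c.support ∧ Γ.Adj a b ∧ s(a, b) ∉ c.edges

/-- The (discrete) right-angled Artin group of a graph: generators are the vertices, and the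
relations say that adjacent vertices commute. -/
abbrev RightAngledArtinGroup {V : Type u} (Γ : SimpleGraph V) : Type u :=
  PresentedGroup
    {r : FreeGroup V | ∃ a b : V, Γ.Adj a b ∧ r =
      FreeGroup.of a * FreeGroup.of b * (FreeGroup.of a)⁻¹ * (FreeGroup.of b)⁻¹}

/-- The normal subgroups of `A` whose index is a power of `p`. -/
structure PPowerIndexNormalSubgroup (p : ℕ) (A : Type u) [Group A] : Type u where
  toSubgroup : Subgroup A
  normal : toSubgroup.Normal
  index_eq : ∃ k : ℕ, toSubgroup.index = p ^ k

namespace PPowerIndexNormalSubgroup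

variable {p : ℕ} {A : Type u} [Group A]

instance (N : PPowerIndexNormalSubgroup p A) : N.toSubgroup.Normal := N.normal

/-- The finite `p`-group `A ⧸ N`, with the discrete topology. -/
def Quot (N : PPowerIndexNormalSubgroup p A) : Type u := A ⧸ N.toSubgroup

instance (N : PPowerIndexNormalSubgroup p A) : Group N.Quot :=
  inferInstanceAs (Group (A ⧸ N.toSubgroup))

instance (N : PPowerIndexNormalSubgroup p A) : TopologicalSpace N.Quot := ⊥

instance (N : PPowerIndexNormalSubgroup p A) : DiscreteTopology N.Quot := ⟨rfl⟩

/-- The projection `A ⧸ M → A ⧸ N` for `M ≤ N`. -/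
def map {M N : PPowerIndexNormalSubgroup p A} (h : M.toSubgroup ≤ N.toSubgroup) :
    M.Quot →* N.Quot :=
  QuotientGroup.map M.toSubgroup N.toSubgroup (MonoidHom.id A) h

end PPowerIndexNormalSubgroup

/-- The inverse limit of the quotients `A ⧸ N` as a subgroup of their product, where `N` runs over
the normal subgroups of `p`-power index. -/
def proPCompletionSubgroup (p : ℕ) (A : Type u) [Group A] :
    Subgroup (∀ N : PPowerIndexNormalSubgroup p A, N.Quot) where
  carrier := {x | ∀ (M N : PPowerIndexNormalSubgroup p A) (h : M.toSubgroup ≤ N.toSubgroup),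
    PPowerIndexNormalSubgroup.map h (x M) = x N}
  one_mem' := fun _ _ _ => map_one _
  mul_mem' := fun {x y} hx hy M N h => by
    rw [Pi.mul_apply, Pi.mul_apply, map_mul, hx M N h, hy M N h]
  inv_mem' := fun {x} hx M N h => by
    rw [Pi.inv_apply, Pi.inv_apply, map_inv, hx M N h]

/-- The pro-`p` completion of an abstract group `A`, with the topology of an inverse limit of
finite discrete groups (the one induced by the product topology). -/
abbrev ProPCompletion (p : ℕ) (A : Type u) [Group A] : Type u := proPCompletionSubgroup p A

/-- The right-angled Artin pro-`p` group of a graph: the pro-`p` completion of the right-angled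
Artin group. -/
abbrev RightAngledArtinProPGroup (p : ℕ) {V : Type u} (Γ : SimpleGraph V) : Type u :=
  ProPCompletion p (RightAngledArtinGroup Γ)

/-- `G` is a pro-`p` group: a compact totally disconnected (hence Hausdorff) topological group all
of whose open normal subgroups have `p`-power index. -/
structure IsProPGroup (p : ℕ) (G : Type u) [Group G] [TopologicalSpace G] : Prop where
  isTopologicalGroup : IsTopologicalGroup G
  compactSpace : CompactSpace G
  totallyDisconnectedSpace : TotallyDisconnectedSpace G
  index_eq : ∀ N : Subgroup G, N.Normal → IsOpen (N : Set G) → ∃ k : ℕ, N.index = p ^ k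

/-- The pro-`p` group `G` together with `ι : X → G` is the free pro-`p` group on the pointed
profinite space `(X, x₀)`: `ι` is a continuous map with `ι x₀ = 1`, and every continuous map from
`X` to a pro-`p` group that sends `x₀` to `1` extends uniquely to a continuous homomorphism. -/
structure IsFreeProPGroupOn (p : ℕ) {X : Type u} [TopologicalSpace X] (x₀ : X)
    {G : Type u} [Group G] [TopologicalSpace G] (ι : X → G) : Prop where
  compactSpace : CompactSpace X
  t2Space : T2Space X
  totallyDisconnectedSpace : TotallyDisconnectedSpace X
  isProPGroup : IsProPGroup p G
  continuous : Continuous ι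
  map_base : ι x₀ = 1
  existsUnique_lift : ∀ (H : Type u) [Group H] [TopologicalSpace H], IsProPGroup p H →
    ∀ f : X → H, Continuous f → f x₀ = 1 → ∃! φ : G →ₜ* H, ∀ x : X, φ (ι x) = f x

/-- `G` is a free pro-`p` group, i.e. it is free pro-`p` on some pointed profinite space. (Bases
that are sets converging to `1` are the case of a one-point compactification of a discrete
space.) -/
def IsFreeProPGroup (p : ℕ) (G : Type u) [Group G] [TopologicalSpace G] : Prop :=
  ∃ (X : Type u) (_ : TopologicalSpace X) (x₀ : X) (ι : X → G), IsFreeProPGroupOn p x₀ ι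

/-! Write N for the closed commutator subgroup of the pro-p group G of Γ. Two arguments combine.

Freeness is reduced to a lifting problem (`IsProPGroup.isFreeProPGroup_of_hasCentralLifting`): a
first countable pro-p group is free if its continuous homomorphisms to finite p-groups lift along
central extensions of finite p-groups with kernel of exponent p. The basis is a countable set of
points accumulating only at 1, together with 1, dual to the characters N → ℤ/p. Pointed maps on it
extend uniquely to finite p-groups by induction on the order, splitting off a central subgroup of
order p, and then to pro-p groups by compactness.

To solve the lifting problem for φ : N → P and E → P, induce φ to a wreath product by the
Kaloujnine–Krasner construction. On the generators this is a family of functions f_v : ℤ^V → P,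
periodic modulo a power of p, and an edge vw says f_v(x) f_w(x + e_v) = f_w(x) f_v(x + e_w). It
suffices to lift this family to E, keeping periodicity and the edge relations
(`SimpleGraph.IsChordalGraph.exists_periodic_lift`). By Dirac's theorem there is a vertex v whose
neighbours form a clique; lift the other functions by induction and f_v arbitrarily. The errors in
the relations at v are central and, because the neighbours commute with each other, form a closed
discrete 1-form. Such a form is exact after enlarging the period (`exists_difference_eq_of_closed`),
and its primitive corrects the lift of f_v. -/

namespace SimpleGraph

/-! ### Chordal graphs and simplicial vertices (Dirac's theorem). -/

variable {V : Type u} {Γ : SimpleGraph V}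

/-- Geodesics have no chords: an edge between non-consecutive vertices would give a shortcut. -/
theorem Walk.mk_mem_edges_of_length_eq_dist {s t a b : V} (p : Γ.Walk s t)
    (hp : p.length = Γ.dist s t) (ha : a ∈ p.support) (hb : b ∈ p.support) (hab : Γ.Adj a b) :
    s(a, b) ∈ p.edges := by
  obtain ⟨i, rfl, hi⟩ := Walk.mem_support_iff_exists_getVert.1 ha
  obtain ⟨j, rfl, hj⟩ := Walk.mem_support_iff_exists_getVert.1 hb
  have key : ∀ {i j : ℕ}, i ≤ p.length → j ≤ p.length → i < j →
      Γ.Adj (p.getVert i) (p.getVert j) → s(p.getVert i, p.getVert j) ∈ p.edges := by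
    intro i j hi hj hij h
    have h1 := Γ.dist_le (((p.take i).concat h).append (p.drop j))
    simp only [Walk.length_append, Walk.length_concat, Walk.take_length, Walk.drop_length] at h1
    obtain rfl : j = i + 1 := by omega
    rw [Walk.edges, List.mem_map]
    have hl : i < p.darts.length := by simpa using hij.trans_le hj
    refine ⟨p.darts[i], List.getElem_mem _, ?_⟩
    rw [Walk.darts_getElem_eq_getVert]
    rfl
  rcases lt_trichotomy i j with h | rfl | h
  · exact key hi hj h hab
  · exact (hab.ne rfl).elim
  · rw [Sym2.eq_swap]
    exact key hj hi h hab.symm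

/-- Two neighbours of a vertex `v` joined by a path that avoids the other neighbours of `v`
are adjacent in a chordal graph. -/
theorem IsChordalGraph.adj_of_reachable (hΓ : Γ.IsChordalGraph) {v s t : V} {D : Set V}
    (hvs : Γ.Adj v s) (hvt : Γ.Adj v t) (hst : s ≠ t) (hvD : v ∉ D) (hs : s ∈ D) (ht : t ∈ D)
    (hD : ∀ c ∈ D, Γ.Adj v c → c = s ∨ c = t)
    (hr : (Γ.induce D).Reachable ⟨s, hs⟩ ⟨t, ht⟩) : Γ.Adj s t := by
  by_contra hnadj
  -- Close a geodesic of the induced graph on `D` to a circuit through `v`. A chord at `v` is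
  -- excluded by `hD`, a chord within the path by minimality.
  obtain ⟨p, hp⟩ := hr.exists_walk_length_eq_dist
  have hpath := p.isPath_of_length_eq_dist hp
  have hlen : 1 < p.length := by
    rw [hp]
    exact hr.one_lt_dist_of_ne_of_not_adj (fun h => hst (congrArg Subtype.val h))
      (by simpa using hnadj)
  let q : Γ.Walk s t := p.map (Embedding.induce D).toHom
  have hqs : q.support = p.support.map (Embedding.induce D).toHom := Walk.support_map _ _
  have hqe : q.edges = p.edges.map (Sym2.map (Embedding.induce D).toHom) := Walk.edges_map _ _
  have hqD : ∀ x ∈ q.support, x ∈ D := by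
    intro x hx
    rw [hqs, List.mem_map] at hx
    obtain ⟨y, -, rfl⟩ := hx
    exact y.2
  have hq : q.IsPath := hpath.map Subtype.val_injective
  have hqlen : q.length = p.length := Walk.length_map _ _
  have hvq : v ∉ q.support := fun h => hvD (hqD v h)
  have hcyc : (Walk.cons hvs (q.concat hvt.symm)).IsCycle := by
    rw [Walk.cons_isCycle_iff]
    refine ⟨hq.concat hvq _, ?_⟩
    rw [Walk.edges_concat, List.concat_eq_append, List.mem_append, List.mem_singleton]
    rintro (h | h)
    · exact hvq (q.fst_mem_support_of_mem_edges h)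
    · rw [Sym2.eq_swap] at h
      exact hst (Sym2.congr_left.1 h)
  obtain ⟨a, b, ha, hb, hab, he⟩ := hΓ v _ hcyc (by
    rw [Walk.length_cons, Walk.length_concat]; omega)
  rw [Walk.edges_cons, Walk.edges_concat, List.concat_eq_append] at he
  simp only [List.mem_cons, List.mem_append, List.not_mem_nil, or_false, not_or] at he
  have hv : ∀ c, Γ.Adj v c → s(v, c) ≠ s(v, s) → s(v, c) ≠ s(t, v) → c ∈ q.support → False := by
    intro c hc h1 h2 hcq
    rcases hD c (hqD c hcq) hc with rfl | rfl
    · exact h1 rfl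
    · exact h2 Sym2.eq_swap
  have hsupp : ∀ x, x ∈ (Walk.cons hvs (q.concat hvt.symm)).support → x = v ∨ x ∈ q.support := by
    intro x hx
    rw [Walk.support_cons, Walk.support_concat] at hx
    simp only [List.mem_cons, List.mem_append, List.not_mem_nil, or_false] at hx
    tauto
  rcases hsupp a ha with rfl | ha'
  · rcases hsupp b hb with rfl | hb'
    · exact hab.ne rfl
    · exact hv b hab he.1 he.2.2 hb'
  · rcases hsupp b hb with rfl | hb'
    · rw [Sym2.eq_swap] at he
      exact hv a hab.symm he.1 he.2.2 ha'
    · refine he.2.1 ?_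
      rw [hqe]
      rw [hqs, List.mem_map] at ha' hb'
      obtain ⟨a', ha', rfl⟩ := ha'
      obtain ⟨b', hb', rfl⟩ := hb'
      exact List.mem_map.2 ⟨s(a', b'),
        p.mk_mem_edges_of_length_eq_dist hp ha' hb' hab, rfl⟩

/-- The neighbours of `x` in the set `W` are pairwise adjacent. -/
def IsSimplicialIn (Γ : SimpleGraph V) (W : Set V) (x : V) : Prop :=
  ∀ a ∈ W, ∀ b ∈ W, Γ.Adj x a → Γ.Adj x b → a ≠ b → Γ.Adj a b

/-- Dirac's theorem in the form that survives induction: prescribing a vertex `v` to be avoided lets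
the simplicial vertex be kept out of a separating clique. -/
theorem IsChordalGraph.exists_isSimplicialIn_of_not_adj (hΓ : Γ.IsChordalGraph) (n : ℕ) :
    ∀ W : Set V, W.Finite → W.ncard = n → ∀ v ∈ W, (∃ u ∈ W, u ≠ v ∧ ¬ Γ.Adj v u) →
      ∃ x ∈ W, x ≠ v ∧ ¬ Γ.Adj v x ∧ Γ.IsSimplicialIn W x := by
  induction n using Nat.strong_induction_on with
  | _ n ih =>
    rintro W hW rfl v hv ⟨u, huW, huv, hvu⟩
    let F : Set V := {x ∈ W | x ≠ v ∧ ¬ Γ.Adj v x}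
    have hu : u ∈ F := ⟨huW, huv, hvu⟩
    -- `C` is the component of `u` among the non-neighbours of `v`, and `S` is its boundary. Any two
    -- points of `S` are joined through `C`, so `S` is a clique; all neighbours in `W` of a point of
    -- `C` lie in `C ∪ S`, which omits `v`.
    let C : Set V := {x | ∃ h : x ∈ F, (Γ.induce F).Reachable ⟨u, hu⟩ ⟨x, h⟩}
    let S : Set V := {s ∈ W | Γ.Adj v s ∧ ∃ c ∈ C, Γ.Adj s c}
    have hS : ∀ s ∈ S, ∀ t ∈ S, s ≠ t → Γ.Adj s t := by
      rintro s ⟨-, hvs, c, ⟨hcF, hc⟩, hsc⟩ t ⟨-, hvt, d, ⟨hdF, hd⟩, htd⟩ hst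
      let D : Set V := F ∪ {s, t}
      have hsD : s ∈ D := Or.inr (Or.inl rfl)
      have htD : t ∈ D := Or.inr (Or.inr rfl)
      refine hΓ.adj_of_reachable (D := D) hvs hvt hst ?_ hsD htD ?_ ?_
      · rintro (h | h | h)
        · exact h.2.1 rfl
        · exact hvs.ne h
        · exact hvt.ne h
      · rintro x (h | h | h) hx
        · exact (h.2.2 hx).elim
        · exact Or.inl h
        · exact Or.inr h
      · have h1 : (Γ.induce D).Reachable ⟨c, Or.inl hcF⟩ ⟨d, Or.inl hdF⟩ :=
          (hc.symm.trans hd).map (induceHomOfLE Γ Set.subset_union_left).toHom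
        have h2 : (Γ.induce D).Adj ⟨s, hsD⟩ ⟨c, Or.inl hcF⟩ := hsc
        have h3 : (Γ.induce D).Adj ⟨d, Or.inl hdF⟩ ⟨t, htD⟩ := htd.symm
        exact (h2.reachable.trans h1).trans h3.reachable
    have hCF : C ⊆ F := fun x hx => hx.1
    have hnb : ∀ x ∈ C, ∀ a ∈ W, Γ.Adj x a → a ∈ C ∪ S := by
      intro x hx a ha hxa
      by_cases hva : Γ.Adj v a
      · exact Or.inr ⟨ha, hva, x, hx, hxa.symm⟩
      · have haF : a ∈ F := ⟨ha, fun h => (hCF hx).2.2 (h ▸ hxa.symm), hva⟩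
        refine Or.inl ⟨haF, hx.2.trans (Adj.reachable ?_)⟩
        exact hxa
    have hTW : C ∪ S ⊆ W := Set.union_subset (fun x hx => (hCF hx).1) (fun x hx => hx.1)
    have hlt : (C ∪ S).ncard < W.ncard := Set.ncard_lt_ncard
      ⟨hTW, fun h => by
        rcases h hv with h | h
        · exact (hCF h).2.1 rfl
        · exact h.2.1.ne rfl⟩ hW
    have hfin := hW.subset hTW
    suffices ∃ x ∈ C, Γ.IsSimplicialIn (C ∪ S) x by
      obtain ⟨x, hx, hsx⟩ := this
      refine ⟨x, (hCF hx).1, (hCF hx).2.1, (hCF hx).2.2, fun a ha b hb hxa hxb hab => ?_⟩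
      exact hsx a (hnb x hx a ha hxa) b (hnb x hx b hb hxb) hxa hxb hab
    -- The simplicial vertex must land in `C`. Avoiding some `s ∈ S` does this since `S` is a
    -- clique. If every `s` is adjacent to all the rest, avoiding any suitable `c ∈ C` does it; if
    -- there is none, `C ∪ S` is complete.
    by_cases h1 : ∃ s ∈ S, ∃ y ∈ C ∪ S, y ≠ s ∧ ¬ Γ.Adj s y
    · obtain ⟨s, hs, hy⟩ := h1
      obtain ⟨x, hx, hxs, hsx, hsimp⟩ := ih _ hlt _ hfin rfl s (Or.inr hs) hy
      refine ⟨x, hx.resolve_right fun h => hsx (hS s hs x h hxs.symm), hsimp⟩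
    · push Not at h1
      by_cases h2 : ∃ c ∈ C, ∃ y ∈ C ∪ S, y ≠ c ∧ ¬ Γ.Adj c y
      · obtain ⟨c, hc, hy⟩ := h2
        obtain ⟨x, hx, hxc, hcx, hsimp⟩ := ih _ hlt _ hfin rfl c (Or.inl hc) hy
        refine ⟨x, hx.resolve_right fun h => hcx (h1 x h c (Or.inl hc) hxc.symm).symm, hsimp⟩
      · push Not at h2
        refine ⟨u, ⟨hu, Reachable.refl _⟩, fun a ha b hb _ _ hab => ?_⟩
        rcases ha with ha | ha
        · exact h2 a ha b hb hab.symm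
        · exact h1 a ha b hb hab.symm

theorem IsChordalGraph.exists_isSimplicialIn (hΓ : Γ.IsChordalGraph) {W : Set V} (hW : W.Finite)
    (hne : W.Nonempty) : ∃ x ∈ W, Γ.IsSimplicialIn W x := by
  by_cases h : ∃ v ∈ W, ∃ u ∈ W, u ≠ v ∧ ¬ Γ.Adj v u
  · obtain ⟨v, hv, hu⟩ := h
    obtain ⟨x, hx, -, -, hs⟩ := hΓ.exists_isSimplicialIn_of_not_adj _ W hW rfl v hv hu
    exact ⟨x, hx, hs⟩
  · push Not at h
    obtain ⟨x, hx⟩ := hne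
    exact ⟨x, hx, fun a ha b hb _ _ hab => h a ha b hb hab.symm⟩

end SimpleGraph

/-! ### Periodic functions on ℤ^V and their difference equations. -/

/-- A function on `ℤ^V` that only depends on the residues of the coordinates modulo some power
of `p`. -/
def PrimePowPeriodic (p : ℕ) {V α : Type*} (f : (V → ℤ) → α) : Prop :=
  ∃ m : ℕ, ∀ x y : V → ℤ, (∀ v, x v ≡ y v [ZMOD (p : ℤ) ^ m]) → f x = f y

namespace PrimePowPeriodic

variable {p : ℕ} {V α β γ : Type*}

theorem exists_forall_ge {f : (V → ℤ) → α} (hf : PrimePowPeriodic p f) :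
    ∃ m : ℕ, ∀ n ≥ m, ∀ x y : V → ℤ, (∀ v, x v ≡ y v [ZMOD (p : ℤ) ^ n]) → f x = f y := by
  obtain ⟨m, hm⟩ := hf
  exact ⟨m, fun n hn x y h => hm x y fun v => (h v).of_dvd (pow_dvd_pow _ hn)⟩

theorem comp {f : (V → ℤ) → α} (hf : PrimePowPeriodic p f) (φ : α → β) :
    PrimePowPeriodic p fun x => φ (f x) := by
  obtain ⟨m, hm⟩ := hf
  exact ⟨m, fun x y h => congrArg φ (hm x y h)⟩

theorem comp₂ {f : (V → ℤ) → α} {g : (V → ℤ) → β} (hf : PrimePowPeriodic p f)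
    (hg : PrimePowPeriodic p g) (φ : α → β → γ) :
    PrimePowPeriodic p fun x => φ (f x) (g x) := by
  obtain ⟨m, hm⟩ := hf.exists_forall_ge
  obtain ⟨n, hn⟩ := hg.exists_forall_ge
  refine ⟨max m n, fun x y h => ?_⟩
  simp only
  rw [hm _ (le_max_left _ _) x y h, hn _ (le_max_right _ _) x y h]

theorem add_right {f : (V → ℤ) → α} (hf : PrimePowPeriodic p f) (e : V → ℤ) :
    PrimePowPeriodic p fun x => f (x + e) := by
  obtain ⟨m, hm⟩ := hf
  exact ⟨m, fun x y h => hm _ _ fun v => (h v).add_right (e v)⟩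

end PrimePowPeriodic

theorem prod_range_mul_of_periodic {M : Type*} [CommMonoid M] (F : ℕ → M) (a : ℕ)
    (hF : ∀ i, F (i + a) = F i) (k : ℕ) :
    ∏ i ∈ Finset.range (a * k), F i = (∏ i ∈ Finset.range a, F i) ^ k := by
  have h : ∀ k i, F (a * k + i) = F i := by
    intro k
    induction k with
    | zero => simp
    | succ k ih =>
      intro i
      rw [← ih i, mul_add, mul_one, add_right_comm, hF]
  induction k with
  | zero => simp
  | succ k ih => rw [mul_add, mul_one, Finset.prod_range_add, ih, pow_succ]; simp only [h]

section Difference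

variable {p : ℕ} {V : Type*} [DecidableEq V] {M : Type*} [CommGroup M]

/-- A periodic function with values in a group of exponent `p` is the difference in a coordinate
direction of a periodic function, which inherits all invariances in the other directions. -/
theorem PrimePowPeriodic.exists_difference_eq (hp : 0 < p) (hM : ∀ c : M, c ^ p = 1) (u : V)
    {h : (V → ℤ) → M} (hh : PrimePowPeriodic p h) :
    ∃ g : (V → ℤ) → M, PrimePowPeriodic p g ∧ (∀ x, g (x + Pi.single u 1) = g x * h x) ∧
      ∀ w, w ≠ u → (∀ x, h (x + Pi.single w 1) = h x) → ∀ x, g (x + Pi.single w 1) = g x := by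
  obtain ⟨n, hn⟩ := hh
  have hP : (0 : ℤ) < (p : ℤ) ^ (n + 1) := by positivity
  -- Multiply up `h` along the `u`-line from the start of the period. As `h` has period p^n, the
  -- product over p^(n+1) steps is a p-th power, hence trivial, so `g` closes up with period
  -- p^(n+1).
  refine ⟨fun x => ∏ i ∈ Finset.range (x u % (p : ℤ) ^ (n + 1)).toNat,
    h (Function.update x u i), ⟨n + 1, fun x y hxy => ?_⟩, fun x => ?_, fun w hw hwh x => ?_⟩
  · have h1 : x u % (p : ℤ) ^ (n + 1) = y u % (p : ℤ) ^ (n + 1) := hxy u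
    simp only [h1]
    refine Finset.prod_congr rfl fun i _ => hn _ _ fun v => ?_
    rcases eq_or_ne v u with rfl | hv
    · simp only [Function.update_self]; rfl
    · simp only [Function.update_of_ne hv]
      exact (hxy v).of_dvd (pow_dvd_pow _ n.le_succ)
  · have hup : ∀ i : ℤ, Function.update (x + Pi.single u 1) u i = Function.update x u i := by
      intro i
      ext v
      rcases eq_or_ne v u with rfl | hv
      · simp
      · simp [hv]
    have hr0 := Int.emod_nonneg (x u) hP.ne'
    have hr1 := Int.emod_lt_of_pos (x u) hP
    obtain ⟨r, hr⟩ := Int.eq_ofNat_of_zero_le hr0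
    have hhx : h (Function.update x u (r : ℤ)) = h x := by
      refine hn _ _ fun v => ?_
      rcases eq_or_ne v u with rfl | hv
      · rw [Function.update_self, ← hr]
        exact (Int.mod_modEq _ _).of_dvd (pow_dvd_pow _ n.le_succ)
      · rw [Function.update_of_ne hv]
    have hsucc : (∏ i ∈ Finset.range r, h (Function.update x u (i : ℤ))) * h x =
        ∏ i ∈ Finset.range (r + 1), h (Function.update x u (i : ℤ)) := by
      rw [Finset.prod_range_succ, hhx]
    have hadd : (x + Pi.single u 1 : V → ℤ) u % (p : ℤ) ^ (n + 1) =
        ((r : ℤ) + 1) % (p : ℤ) ^ (n + 1) := by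
      rw [← hr]
      simp
    simp only [hup, hadd, hr, Int.toNat_natCast, hsucc]
    rw [hr] at hr1
    rcases (show (r : ℤ) + 1 ≤ (p : ℤ) ^ (n + 1) from hr1).lt_or_eq with hlt | heq
    · rw [Int.emod_eq_of_lt (by positivity) hlt]
      rfl
    · rw [heq, Int.emod_self]
      have : r + 1 = p ^ n * p := by rw [← pow_succ]; exact_mod_cast heq
      rw [this, prod_range_mul_of_periodic, hM]
      · simp
      · intro i
        refine hn _ _ fun v => ?_
        rcases eq_or_ne v u with rfl | hv
        · simp only [Function.update_self]
          push_cast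
          simp
        · simp only [Function.update_of_ne hv]; rfl
  · have h1 : (x + Pi.single w 1 : V → ℤ) u = x u := by simp [hw.symm]
    simp only [h1]
    refine Finset.prod_congr rfl fun i _ => ?_
    rw [← hwh (Function.update x u i)]
    congr 1
    ext v
    rcases eq_or_ne v u with rfl | hv
    · simp [hw.symm]
    · simp [hv]

/-- A closed discrete `1`-form on `ℤ^K` with periodic coefficients of exponent `p` is exact. -/
theorem exists_difference_eq_of_closed (hp : 0 < p) (hM : ∀ c : M, c ^ p = 1) (K : Finset V)
    (b : V → (V → ℤ) → M) (hb : ∀ w ∈ K, PrimePowPeriodic p (b w))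
    (hcl : ∀ u ∈ K, ∀ w ∈ K, ∀ x,
      b w (x + Pi.single u 1) * b u x = b u (x + Pi.single w 1) * b w x) :
    ∃ g : (V → ℤ) → M, PrimePowPeriodic p g ∧
      ∀ w ∈ K, ∀ x, g (x + Pi.single w 1) = g x * b w x := by
  induction K using Finset.induction_on with
  | empty => exact ⟨fun _ => 1, ⟨0, fun _ _ _ => rfl⟩, by simp⟩
  | insert u K hu ih =>
    obtain ⟨g, hg, hgb⟩ := ih (fun w hw => hb w (Finset.mem_insert_of_mem hw))
      fun u hu w hw => hcl u (Finset.mem_insert_of_mem hu) w (Finset.mem_insert_of_mem hw)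
    -- This is what `g` still misses in direction `u`. Closedness makes it invariant in the
    -- directions of `K`, so its primitive along `u` does not disturb the equations already solved.
    have hh : PrimePowPeriodic p fun x => b u x * g x * (g (x + Pi.single u 1))⁻¹ :=
      ((hb u (Finset.mem_insert_self _ _)).comp₂ hg (· * ·)).comp₂
        (hg.add_right _) (fun c d => c * d⁻¹)
    obtain ⟨g', hg', hgu, hgw⟩ := hh.exists_difference_eq hp hM u
    refine ⟨fun x => g x * g' x, hg.comp₂ hg' (· * ·), fun w hw x => ?_⟩
    rcases Finset.mem_insert.1 hw with rfl | hw'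
    · simp only [hgu]
      rw [mul_comm (g x) (g' x), mul_assoc (g' x), mul_comm, mul_assoc, mul_assoc (b w x * g x),
        inv_mul_cancel, mul_one, mul_comm (b w x)]
    · have hwu : w ≠ u := fun h => hu (h ▸ hw')
      simp only
      rw [hgw w hwu, hgb w hw', mul_right_comm]
      intro y
      rw [add_right_comm, hgb w hw' y, hgb w hw', mul_inv_rev]
      have := hcl u (Finset.mem_insert_self _ _) w hw y
      calc _ = (b u (y + Pi.single w 1) * b w y) *
            ((b w (y + Pi.single u 1))⁻¹ * (g y * (g (y + Pi.single u 1))⁻¹)) := by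
            simp only [mul_comm, mul_left_comm, mul_assoc]
        _ = _ := by
            rw [← this, mul_comm (b w _), mul_assoc, mul_inv_cancel_left, mul_assoc]

end Difference

/-! ### Lifting periodic families along central extensions. -/

/-- A family of periodic functions that satisfies the commutation relations of a chordal graph
lifts along a central extension with kernel of exponent `p`. -/
theorem SimpleGraph.IsChordalGraph.exists_periodic_lift {p : ℕ} (hp : 0 < p) {V : Type u}
    [DecidableEq V] {Γ : SimpleGraph V} (hΓ : Γ.IsChordalGraph) {E P : Type*} [Group E] [Group P]
    (π : E →* P) (hπ : Function.Surjective π) (hc : π.ker ≤ Subgroup.center E)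
    (hexp : ∀ k ∈ π.ker, k ^ p = 1) (f : V → (V → ℤ) → P) (hf : ∀ v, PrimePowPeriodic p (f v))
    (hsq : ∀ v w, Γ.Adj v w → ∀ x,
      f v x * f w (x + Pi.single v 1) = f w x * f v (x + Pi.single w 1)) (W : Finset V) :
    ∃ F : V → (V → ℤ) → E, (∀ v ∈ W, PrimePowPeriodic p (F v)) ∧
      (∀ v ∈ W, ∀ x, π (F v x) = f v x) ∧
      ∀ v ∈ W, ∀ w ∈ W, Γ.Adj v w → ∀ x,
        F v x * F w (x + Pi.single v 1) = F w x * F v (x + Pi.single w 1) := by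
  classical
  induction W using Finset.strongInduction with
  | _ W ih =>
    rcases W.eq_empty_or_nonempty with rfl | hne
    · exact ⟨fun _ _ => 1, by simp⟩
    obtain ⟨v, hv, hsimp⟩ := hΓ.exists_isSimplicialIn W.finite_toSet hne
    obtain ⟨F, hFp, hFπ, hFsq⟩ := ih (W.erase v) (Finset.erase_ssubset hv)
    obtain ⟨σ, hσ⟩ := hπ.hasRightInverse
    let F₀ : (V → ℤ) → E := fun x => σ (f v x)
    have hF₀ : PrimePowPeriodic p F₀ := (hf v).comp σ
    have hF₀π : ∀ x, π (F₀ x) = f v x := fun x => hσ _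
    let K : Finset V := (W.erase v).filter (Γ.Adj v)
    have hKW : ∀ w ∈ K, w ∈ W.erase v := fun w hw => (Finset.mem_filter.1 hw).1
    have hKv : ∀ w ∈ K, Γ.Adj v w := fun w hw => (Finset.mem_filter.1 hw).2
    let : CommGroup π.ker :=
      { mul_comm := fun a b => Subtype.ext (Subgroup.mem_center_iff.1 (hc b.2) a) }
    have hcomm : ∀ (k : π.ker) (e : E), e * k = k * e := fun k e =>
      Subgroup.mem_center_iff.1 (hc k.2) e
    -- The defect of the relation between `v` and `w` for the arbitrary lift `F₀`.
    let d : V → (V → ℤ) → E := fun w x =>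
      F₀ x * F w (x + Pi.single v 1) * (F w x * F₀ (x + Pi.single w 1))⁻¹
    have hd : ∀ w ∈ K, ∀ x, d w x ∈ π.ker := by
      intro w hw x
      rw [MonoidHom.mem_ker]
      simp only [d, map_mul, map_inv, hF₀π, hFπ w (hKW w hw), hsq v w (hKv w hw) x,
        mul_inv_cancel]
    let b : V → (V → ℤ) → π.ker := fun w x => if h : w ∈ K then ⟨d w x, hd w h x⟩ else 1
    have hbd : ∀ w ∈ K, ∀ x, (b w x : E) = d w x := by
      intro w hw x
      simp only [b, dif_pos hw]
    have hrel : ∀ w ∈ K, ∀ x,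
        F₀ x * F w (x + Pi.single v 1) = b w x * (F w x * F₀ (x + Pi.single w 1)) := by
      intro w hw x
      simp only [hbd w hw, d, inv_mul_cancel_right]
    have hbper : ∀ w ∈ K, PrimePowPeriodic p (b w) := by
      intro w hw
      have h1 : PrimePowPeriodic p (d w) :=
        (hF₀.comp₂ ((hFp w (hKW w hw)).add_right _) (· * ·)).comp₂
          ((hFp w (hKW w hw)).comp₂ (hF₀.add_right _) (· * ·)) (fun s t => s * t⁻¹)
      obtain ⟨m, hm⟩ := h1
      exact ⟨m, fun x y h => Subtype.ext (by rw [hbd w hw, hbd w hw, hm x y h])⟩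
    -- Moving `F₀` past two neighbours collects their defects. Since `u` and `w` are adjacent, the
    -- two orders of passing them give the same element, and comparing the defects yields
    -- closedness.
    have htriple : ∀ u ∈ K, ∀ w ∈ K, ∀ x,
        F₀ x * F w (x + Pi.single v 1) * F u (x + Pi.single v 1 + Pi.single w 1) =
          (b w x * b u (x + Pi.single w 1) : π.ker) *
            (F w x * F u (x + Pi.single w 1) * F₀ (x + Pi.single w 1 + Pi.single u 1)) := by
      intro u hu w hw x
      rw [hrel w hw, mul_assoc, mul_assoc, add_right_comm, hrel u hu, Subgroup.coe_mul]
      rw [← mul_assoc (F w x) (b u _ : E), hcomm]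
      simp only [mul_assoc]
    have hcl : ∀ u ∈ K, ∀ w ∈ K, ∀ x,
        b w (x + Pi.single u 1) * b u x = b u (x + Pi.single w 1) * b w x := by
      intro u hu w hw x
      rcases eq_or_ne u w with rfl | huw
      · rfl
      have hadj : Γ.Adj u w := hsimp u (Finset.mem_of_mem_erase (hKW u hu)) w
        (Finset.mem_of_mem_erase (hKW w hw)) (hKv u hu) (hKv w hw) huw
      have h1 := htriple u hu w hw x
      have h2 := htriple w hw u hu x
      rw [mul_assoc, hFsq w (hKW w hw) u (hKW u hu) hadj.symm, ← mul_assoc, h2,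
        hFsq w (hKW w hw) u (hKW u hu) hadj.symm, add_right_comm] at h1
      have h3 := Subtype.ext (mul_right_cancel h1)
      rw [mul_comm, h3, mul_comm]
    obtain ⟨g, hg, hgb⟩ := exists_difference_eq_of_closed hp
      (fun c : π.ker => Subtype.ext (hexp c c.2)) K b hbper hcl
    have hnew : ∀ w ∈ K, ∀ x, (g x * F₀ x : E) * F w (x + Pi.single v 1) =
        F w x * (g (x + Pi.single w 1) * F₀ (x + Pi.single w 1)) := by
      intro w hw x
      rw [mul_assoc, hrel w hw, hgb w hw, ← mul_assoc (F w x), hcomm, Subgroup.coe_mul]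
      simp only [mul_assoc]
    have hupd : ∀ w ∈ W, w ≠ v → w ∈ W.erase v := fun w hw h => Finset.mem_erase.2 ⟨h, hw⟩
    refine ⟨Function.update F v fun x => g x * F₀ x, fun w hw => ?_, fun w hw x => ?_, ?_⟩
    · rcases eq_or_ne w v with rfl | hwv
      · rw [Function.update_self]
        exact hg.comp₂ hF₀ (fun c e => (c : E) * e)
      · rw [Function.update_of_ne hwv]
        exact hFp w (hupd w hw hwv)
    · rcases eq_or_ne w v with rfl | hwv
      · rw [Function.update_self, map_mul, (g x).2, one_mul, hF₀π]
      · rw [Function.update_of_ne hwv, hFπ w (hupd w hw hwv)]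
    · intro s hs t ht hst x
      rcases eq_or_ne s v with rfl | hsv
      · have htv : t ≠ s := hst.ne'
        rw [Function.update_self, Function.update_of_ne htv]
        exact hnew t (Finset.mem_filter.2 ⟨hupd t ht htv, hst⟩) x
      · rcases eq_or_ne t v with rfl | htv
        · rw [Function.update_self, Function.update_of_ne hsv]
          exact (hnew s (Finset.mem_filter.2 ⟨hupd s hs hsv, hst.symm⟩) x).symm
        · rw [Function.update_of_ne hsv, Function.update_of_ne htv]
          exact hFsq s (hupd s hs hsv) t (hupd t ht htv) hst x

/-! ### Dual sets of points and bases converging to 1. -/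

section DualSet

variable {F N : Type*} [Field F]

/-- Restriction to `X` is a bijection from the space `W` of functions to the functions on `X`. -/
def IsDualSet (W : Submodule F (N → F)) (X : Set N) : Prop :=
  (∀ χ ∈ W, (∀ x ∈ X, χ x = 0) → χ = 0) ∧ ∀ f : N → F, ∃ χ ∈ W, ∀ x ∈ X, χ x = f x

/-- Pick a point of `S` where some function of `W` is nonzero, and recurse into the hyperplane of
functions vanishing there. -/
theorem exists_finset_isDualSet (S : Set N) (n : ℕ) : ∀ W : Submodule F (N → F),
    FiniteDimensional F W → Module.finrank F W = n → (∀ χ ∈ W, (∀ x ∈ S, χ x = 0) → χ = 0) →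
    ∃ Y : Finset N, (Y : Set N) ⊆ S ∧ IsDualSet W (Y : Set N) := by
  classical
  induction n using Nat.strong_induction_on with
  | _ n ih =>
    rintro W hfd rfl hS
    by_cases hW : W = ⊥
    · subst hW
      exact ⟨∅, by simp, by simp, fun f => ⟨0, by simp⟩⟩
    obtain ⟨χ₀, hχ₀, hne⟩ := W.ne_bot_iff.1 hW
    obtain ⟨x₀, hx₀, hχx⟩ : ∃ x ∈ S, χ₀ x ≠ 0 := by
      by_contra! h
      exact hne (hS χ₀ hχ₀ h)
    let W' : Submodule F (N → F) := W ⊓ LinearMap.ker (LinearMap.proj x₀ : (N → F) →ₗ[F] F)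
    have hlt : W' < W := lt_of_le_of_ne inf_le_left fun h => by
      have : χ₀ ∈ W' := h ▸ hχ₀
      exact hχx this.2
    have hfd' : FiniteDimensional F W' := Submodule.finiteDimensional_of_le hlt.le
    obtain ⟨Y, hYS, hY1, hY2⟩ := ih _ (Submodule.finrank_lt_finrank_of_lt hlt) W' hfd' rfl
      fun χ hχ => hS χ hχ.1
    refine ⟨insert x₀ Y, ?_, fun χ hχ h => ?_, fun f => ?_⟩
    · rw [Finset.coe_insert]
      exact Set.insert_subset hx₀ hYS
    · exact hY1 χ ⟨hχ, h x₀ (Finset.mem_coe.2 (Finset.mem_insert_self _ _))⟩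
        fun x hx => h x (Finset.mem_coe.2 (Finset.mem_insert_of_mem hx))
    · obtain ⟨χ, hχ, hχf⟩ := hY2 (f - (f x₀ / χ₀ x₀) • χ₀)
      refine ⟨χ + (f x₀ / χ₀ x₀) • χ₀, W.add_mem hχ.1 (W.smul_mem _ hχ₀), fun x hx => ?_⟩
      rcases Finset.mem_insert.1 (Finset.mem_coe.1 hx) with rfl | hx
      · have : χ x = 0 := hχ.2
        simp [this, hχx]
      · simp [hχf x hx]

/-- The functions of `W'` vanishing on `X` are separated by `S`: one that also vanishes on `S` lies
in `W`, where `X` detects it. So the new points can be taken in `S`, where `W` vanishes and the old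
functions are not disturbed. With `S` a small neighbourhood of 1, this makes the points converge. -/
theorem IsDualSet.exists_extension {W W' : Submodule F (N → F)} [FiniteDimensional F W']
    {X : Finset N} (hX : IsDualSet W (X : Set N)) (hWW' : W ≤ W') {S : Set N}
    (h0 : ∀ χ ∈ W, ∀ x ∈ S, χ x = 0) (h1 : ∀ χ ∈ W', (∀ x ∈ S, χ x = 0) → χ ∈ W) :
    ∃ X' : Finset N, X ⊆ X' ∧ (∀ x ∈ X', x ∉ X → x ∈ S) ∧ IsDualSet W' (X' : Set N) := by
  classical
  let U : Submodule F (N → F) :=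
    W' ⊓ LinearMap.ker (LinearMap.funLeft F F (Subtype.val : X → N))
  have hU : ∀ χ, χ ∈ U ↔ χ ∈ W' ∧ ∀ x ∈ X, χ x = 0 := by
    intro χ
    rw [Submodule.mem_inf, LinearMap.mem_ker]
    refine and_congr Iff.rfl ⟨fun h x hx => congrFun h ⟨x, hx⟩, fun h => ?_⟩
    ext ⟨x, hx⟩
    exact h x hx
  obtain ⟨Y, hYS, hY1, hY2⟩ := exists_finset_isDualSet S _ U
    (Submodule.finiteDimensional_of_le inf_le_left) rfl fun χ hχ h =>
      hX.1 χ (h1 χ ((hU χ).1 hχ).1 h) ((hU χ).1 hχ).2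
  refine ⟨X ∪ Y, Finset.subset_union_left, fun x hx hxX => ?_, fun χ hχ h => ?_, fun f => ?_⟩
  · exact hYS ((Finset.mem_union.1 hx).resolve_left hxX)
  · exact hY1 χ ((hU χ).2 ⟨hχ, fun x hx => h x (Finset.mem_coe.2 (Finset.mem_union_left _ hx))⟩)
      fun x hx => h x (Finset.mem_coe.2 (Finset.mem_union_right _ hx))
  · obtain ⟨χ, hχ, hχf⟩ := hX.2 f
    obtain ⟨χ', hχ', hχf'⟩ := hY2 f
    refine ⟨χ + χ', W'.add_mem (hWW' hχ) ((hU χ').1 hχ').1, fun x hx => ?_⟩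
    rw [Pi.add_apply]
    rcases Finset.mem_union.1 (Finset.mem_coe.1 hx) with hx | hx
    · rw [hχf x hx, ((hU χ').1 hχ').2 x hx, add_zero]
    · rw [hχf' x hx, h0 χ hχ x (hYS hx), zero_add]

end DualSet

section ModPCharacters

variable (p : ℕ) [Fact p.Prime] (N : Type*) [Group N] [TopologicalSpace N]

/-- The space of continuous homomorphisms to `ℤ/p`. -/
def modPCharacters : Submodule (ZMod p) (N → ZMod p) where
  carrier := {χ | IsLocallyConstant χ ∧ ∀ x y, χ (x * y) = χ x + χ y}
  zero_mem' := ⟨IsLocallyConstant.const 0, by simp⟩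
  add_mem' := fun {a b} ha hb => ⟨ha.1.add hb.1, fun x y => by
    simp only [Pi.add_apply, ha.2, hb.2]; ring⟩
  smul_mem' := fun c a ha => ⟨ha.1.comp (c * ·), fun x y => by
    simp only [Pi.smul_apply, ha.2, smul_eq_mul, mul_add]⟩

variable {p N}

theorem modPCharacters_map_one {χ : N → ZMod p} (hχ : χ ∈ modPCharacters p N) : χ 1 = 0 := by
  have := hχ.2 1 1
  simpa using this

/-- The continuous homomorphisms to `ℤ/p` that vanish on `S`. -/
def modPCharactersVanishing (p : ℕ) [Fact p.Prime] (S : Set N) :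
    Submodule (ZMod p) (N → ZMod p) where
  carrier := {χ | χ ∈ modPCharacters p N ∧ ∀ x ∈ S, χ x = 0}
  zero_mem' := ⟨zero_mem _, by simp⟩
  add_mem' := fun ha hb => ⟨add_mem ha.1 hb.1, fun x hx => by simp [ha.2 x hx, hb.2 x hx]⟩
  smul_mem' := fun c _ ha => ⟨Submodule.smul_mem _ c ha.1, fun x hx => by simp [ha.2 x hx]⟩

/-- Such a character kills an open normal subgroup contained in `S`, so its values on finitely many
coset representatives determine it. -/
theorem finiteDimensional_modPCharactersVanishing [IsTopologicalGroup N] [CompactSpace N]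
    [TotallyDisconnectedSpace N] {S : Set N} (hS : S ∈ nhds 1) :
    FiniteDimensional (ZMod p) (modPCharactersVanishing p S) := by
  obtain ⟨O, hOS, hO, h1O⟩ := mem_nhds_iff.1 hS
  obtain ⟨T, hT⟩ := ProfiniteGrp.exist_openNormalSubgroup_sub_open_nhds_of_one hO h1O
  have : Finite (N ⧸ T.toSubgroup) := T.toSubgroup.quotient_finite_of_isOpen T.isOpen'
  have hfin : Finite (modPCharactersVanishing p S) := by
    refine Finite.of_injective
      (fun χ => fun q : N ⧸ T.toSubgroup => (χ : N → ZMod p) q.out) fun χ χ' h => ?_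
    ext x
    obtain ⟨t, ht⟩ := QuotientGroup.mk_out_eq_mul T.toSubgroup x
    have h1 := congrFun h (x : N ⧸ T.toSubgroup)
    simp only [ht, χ.2.1.2, χ'.2.1.2, χ.2.2 t (hOS (hT t.2)), χ'.2.2 t (hOS (hT t.2)),
      add_zero] at h1
    exact h1
  exact Module.Finite.of_finite

/-- A first countable profinite group contains a closed subset on which the continuous
homomorphisms to `ℤ/p` restrict bijectively to the pointed continuous functions. -/
theorem exists_isClosed_modPCharacters_bijective [IsTopologicalGroup N] [CompactSpace N]
    [TotallyDisconnectedSpace N] [FirstCountableTopology N] :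
    ∃ X : Set N, IsClosed X ∧ 1 ∈ X ∧
      (∀ χ ∈ modPCharacters p N, (∀ x ∈ X, χ x = 0) → χ = 0) ∧
      ∀ f : X → ZMod p, IsLocallyConstant f → (∀ x : X, (x : N) = 1 → f x = 0) →
        ∃ χ ∈ modPCharacters p N, ∀ x : X, χ x = f x := by
  classical
  obtain ⟨s, hs⟩ := (nhds (1 : N)).exists_antitone_basis
  have hmem : ∀ k, s k ∈ nhds (1 : N) := fun k => hs.1.mem_of_mem trivial
  let W : ℕ → Submodule (ZMod p) (N → ZMod p) := fun k => modPCharactersVanishing p (s k)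
  have hfd : ∀ k, FiniteDimensional (ZMod p) (W k) := fun k =>
    finiteDimensional_modPCharactersVanishing (hmem k)
  have hexh : ∀ χ ∈ modPCharacters p N, ∃ k, χ ∈ W k := by
    intro χ hχ
    obtain ⟨k, -, hk⟩ := hs.1.mem_iff.1
      ((hχ.1.isOpen_fiber 0).mem_nhds (modPCharacters_map_one hχ))
    exact ⟨k, hχ, fun x hx => hk hx⟩
  obtain ⟨X₀, -, hX₀⟩ := exists_finset_isDualSet Set.univ _ (W 0) (hfd 0) rfl
    fun χ _ h => funext fun x => h x trivial
  have hstep : ∀ k (X : Finset N), IsDualSet (W k) (X : Set N) →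
      ∃ X' : Finset N, X ⊆ X' ∧ (∀ x ∈ X', x ∉ X → x ∈ s k) ∧
        IsDualSet (W (k + 1)) (X' : Set N) := by
    intro k X hX
    have hle : W k ≤ W (k + 1) := fun χ hχ =>
      (show χ ∈ modPCharacters p N ∧ ∀ x ∈ s (k + 1), χ x = 0 from
        ⟨hχ.1, fun x hx => hχ.2 x (hs.2 k.le_succ hx)⟩)
    refine hX.exists_extension hle
      (fun χ hχ => hχ.2) fun χ hχ h =>
        (show χ ∈ modPCharacters p N ∧ ∀ x ∈ s k, χ x = 0 from ⟨hχ.1, h⟩)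
  choose next hsub hnew hdual using hstep
  let Z : ∀ k, {X : Finset N // IsDualSet (W k) (X : Set N)} := fun k =>
    Nat.rec ⟨X₀, hX₀⟩ (fun k X => ⟨next k X.1 X.2, hdual k X.1 X.2⟩) k
  have hZmono : Monotone fun k => (Z k).1 := monotone_nat_of_le_succ fun k => hsub k _ _
  have hZnew : ∀ k l, ∀ x ∈ (Z l).1, x ∉ (Z k).1 → x ∈ s k := by
    intro k l
    induction l with
    | zero => exact fun x hx hxk => (hxk (hZmono (Nat.zero_le k) hx)).elim
    | succ l ih =>
      intro x hx hxk
      by_cases hxl : x ∈ (Z l).1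
      · exact ih x hxl hxk
      · have hkl : k ≤ l := by
          by_contra! h
          exact hxk (hZmono (Nat.succ_le_of_lt h) hx)
        exact hs.2 hkl (hnew l _ (Z l).2 x hx hxl)
  -- Outside the finite set `Z k` all points of `X` lie in `s k`; thus they accumulate only at 1,
  -- which is why `X` is closed.
  let X : Set N := {x | x = 1 ∨ ∃ k, x ∈ (Z k).1}
  have hXs : ∀ k, ∀ x ∈ X, x ∉ (Z k).1 → x ∈ s k := by
    rintro k x (rfl | ⟨l, hl⟩) hx
    · exact mem_of_mem_nhds (hmem k)
    · exact hZnew k l x hl hx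
  refine ⟨X, ?_, Or.inl rfl, fun χ hχ h => ?_, fun f hf hf1 => ?_⟩
  · rw [← isOpen_compl_iff, isOpen_iff_mem_nhds]
    intro y hy
    have hy1 : (1 : N) ≠ y := fun h => hy (Or.inl h.symm)
    obtain ⟨O, O', hO, hO', h1O, hyO', hdisj⟩ := t2_separation hy1
    obtain ⟨k, -, hk⟩ := hs.1.mem_iff.1 (hO.mem_nhds h1O)
    have hyZ : y ∉ ((Z k).1 : Set N) := fun h => hy (Or.inr ⟨k, h⟩)
    filter_upwards [hO'.mem_nhds hyO', (Z k).1.finite_toSet.isClosed.isOpen_compl.mem_nhds hyZ]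
      with z hz hzZ hzX
    exact Set.disjoint_left.1 hdisj (hk (hXs k z hzX hzZ)) hz
  · obtain ⟨k, hk⟩ := hexh χ hχ
    exact (Z k).2.1 χ hk fun x hx => h x (Or.inr ⟨k, hx⟩)
  · have h1X : (1 : N) ∈ X := Or.inl rfl
    have hf0 : ∀ᶠ x : X in nhds ⟨1, h1X⟩, f x = 0 := by
      filter_upwards [(hf.isOpen_fiber 0).mem_nhds (hf1 ⟨1, h1X⟩ rfl)] with x hx using hx
    rw [nhds_subtype_eq_comap, Filter.eventually_comap] at hf0
    obtain ⟨k, -, hk⟩ := hs.1.mem_iff.1 hf0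
    -- Matching `f` on the finite set `Z k` suffices: at the other points of `X`, which lie in `s
    -- k`, both `χ ∈ W k` and `f` vanish.
    obtain ⟨χ, hχ, hχf⟩ := (Z k).2.2 fun x => if h : x ∈ X then f ⟨x, h⟩ else 0
    refine ⟨χ, hχ.1, fun x => ?_⟩
    by_cases hx : (x : N) ∈ (Z k).1
    · rw [hχf x hx, dif_pos x.2]
    · have hxs := hXs k x x.2 hx
      rw [hχ.2 x hxs]
      exact (hk hxs x rfl).symm

end ModPCharacters

/-! ### The freeness criterion. -/

/-- Central extensions of finite `p`-groups with kernel of exponent `p` have the lifting property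
for continuous homomorphisms from `N`. -/
def HasCentralLifting (p : ℕ) (N : Type u) [Group N] [TopologicalSpace N] : Prop :=
  ∀ (E P : Type u) [Group E] [Group P] [Finite E], IsPGroup p E → ∀ π : E →* P,
    Function.Surjective π → π.ker ≤ Subgroup.center E → (∀ k ∈ π.ker, k ^ p = 1) →
    ∀ φ : N →* P, IsLocallyConstant φ → ∃ φ' : N →* E, IsLocallyConstant φ' ∧ ∀ x, π (φ' x) = φ x

theorem IsPGroup.exists_central_orderOf_eq {p : ℕ} [Fact p.Prime] {P : Type*} [Group P] [Finite P]
    [Nontrivial P] (hP : IsPGroup p P) : ∃ c ∈ Subgroup.center P, orderOf c = p := by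
  have := hP.center_nontrivial
  have hdvd : p ∣ Nat.card (Subgroup.center P) := by
    obtain ⟨n, hn, hcard⟩ :=
      (IsPGroup.nontrivial_iff_card (hP.to_subgroup (Subgroup.center P))).1 this
    exact hcard ▸ dvd_pow_self p hn.ne'
  obtain ⟨c, hc⟩ := exists_prime_orderOf_dvd_card' p hdvd
  exact ⟨c, c.2, by rwa [Subgroup.orderOf_coe]⟩

section Extension

variable {p : ℕ} [Fact p.Prime] {N : Type u} [Group N] [TopologicalSpace N]

/-- If the homomorphisms from `N` to `ℤ/p` restrict bijectively to the pointed functions on `X`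
and `N` has the lifting property, then pointed maps from `X` to finite `p`-groups extend uniquely
to `N`. -/
theorem HasCentralLifting.existsUnique_extension (hN : HasCentralLifting p N) {X : Set N}
    (hX1 : ∀ χ ∈ modPCharacters p N, (∀ x ∈ X, χ x = 0) → χ = 0)
    (hX2 : ∀ f : X → ZMod p, IsLocallyConstant f → (∀ x : X, (x : N) = 1 → f x = 0) →
        ∃ χ ∈ modPCharacters p N, ∀ x : X, χ x = f x) (n : ℕ) :
    ∀ (P : Type u) [Group P] [Finite P], IsPGroup p P → Nat.card P = n →
      ∀ f : X → P, IsLocallyConstant f → (∀ x : X, (x : N) = 1 → f x = 1) →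
        ∃! φ : N →* P, IsLocallyConstant φ ∧ ∀ x : X, φ x = f x := by
  induction n using Nat.strong_induction_on with
  | _ n ih =>
    rintro P _ _ hP rfl f hf hf1
    rcases subsingleton_or_nontrivial P with _ | _
    · exact ⟨1, ⟨IsLocallyConstant.const 1, fun x => Subsingleton.elim _ _⟩,
        fun φ _ => MonoidHom.ext fun x => Subsingleton.elim _ _⟩
    obtain ⟨c, hc, hcp⟩ := hP.exists_central_orderOf_eq
    let M : Subgroup P := Subgroup.zpowers c
    have hMc : M ≤ Subgroup.center P := by simpa [M] using hc
    have : M.Normal := ⟨fun k hk g => by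
      rw [Subgroup.mem_center_iff.1 (hMc hk) g, mul_inv_cancel_right]; exact hk⟩
    have hcomm : ∀ (k : M) (g : P), g * k = k * g := fun k g =>
      Subgroup.mem_center_iff.1 (hMc k.2) g
    have hMcard : Nat.card M = p := by rw [Nat.card_zpowers, hcp]
    let e : Multiplicative (ZMod p) ≃* M := mulEquivOfPrimeCardEq (p := p)
      (by rw [Nat.card_congr Multiplicative.toAdd, Nat.card_zmod]) hMcard
    let π : P →* P ⧸ M := QuotientGroup.mk' M
    have hker : π.ker = M := QuotientGroup.ker_mk' M
    have hlt : Nat.card (P ⧸ M) < Nat.card P := by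
      rw [Subgroup.card_eq_card_quotient_mul_card_subgroup M, hMcard]
      exact lt_mul_of_one_lt_right Nat.card_pos (Fact.out : p.Prime).one_lt
    obtain ⟨ψ, ⟨hψ, hψf⟩, hψu⟩ := ih _ hlt (P ⧸ M) (hP.to_quotient M) rfl (fun x => π (f x))
      (hf.comp π) fun x hx => by rw [hf1 x hx, map_one]
    obtain ⟨φ₀, hφ₀, hφψ⟩ := hN P (P ⧸ M) hP π (QuotientGroup.mk'_surjective M)
      (hker.le.trans hMc) (fun k hk => by
        rw [hker] at hk
        have := pow_card_eq_one' (x := (⟨k, hk⟩ : M))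
        rw [hMcard] at this
        exact congrArg Subtype.val this) ψ hψ
    -- The lift `φ₀` need not agree with `f` on `X`, but the discrepancy lies in `M ≅ ℤ/p`; the
    -- character extending it corrects `φ₀`, by centrality again to a homomorphism.
    have hdiff : ∀ x : X, (φ₀ x)⁻¹ * f x ∈ M := fun x => by
      rw [← hker, MonoidHom.mem_ker, map_mul, map_inv, hφψ, hψf, inv_mul_cancel]
    obtain ⟨χ, hχ, hχX⟩ := hX2 (fun x => (e.symm ⟨_, hdiff x⟩).toAdd)
      (by
        have h1 : IsLocallyConstant fun x : X => (φ₀ x)⁻¹ * f x :=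
          (hφ₀.comp_continuous continuous_subtype_val).comp₂ hf fun s t => s⁻¹ * t
        have h2 : IsLocallyConstant fun x : X => (⟨_, hdiff x⟩ : M) :=
          IsLocallyConstant.desc (fun x : X => (⟨_, hdiff x⟩ : M)) Subtype.val h1
            Subtype.val_injective
        exact h2.comp fun m => (e.symm m).toAdd)
      fun x hx => by
        have : (⟨_, hdiff x⟩ : M) = 1 := Subtype.ext (by simp [hf1 x hx, hx])
        rw [this, map_one]
        rfl
    refine ⟨MonoidHom.mk' (fun x => φ₀ x * e (Multiplicative.ofAdd (χ x))) fun x y => ?_,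
      ⟨?_, fun x => ?_⟩, fun φ ⟨hφ, hφf⟩ => ?_⟩
    · rw [hχ.2, ofAdd_add, map_mul, map_mul, Subgroup.coe_mul]
      simp only [mul_assoc]
      rw [← mul_assoc (φ₀ y), hcomm _ (φ₀ y), mul_assoc]
    · exact hφ₀.comp₂ hχ.1 fun s t => s * e (Multiplicative.ofAdd t)
    · simp [hχX]
    -- By uniqueness modulo `M`, any other solution differs from `φ₀` by a character, and `X`
    -- determines that character.
    · have hπφ : π.comp φ = ψ := hψu _ ⟨hφ.comp π, fun x => by simp [hφf]⟩
      have hk : ∀ x, (φ₀ x)⁻¹ * φ x ∈ M := fun x => by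
        rw [← hker, MonoidHom.mem_ker, map_mul, map_inv, hφψ, ← hπφ, MonoidHom.comp_apply,
          inv_mul_cancel]
      let k : N → M := fun x => ⟨_, hk x⟩
      have hφk : ∀ x, φ x = φ₀ x * k x := fun x => by simp [k]
      have hkmul : ∀ x y, k (x * y) = k x * k y := fun x y => by
        apply Subtype.ext
        simp only [k, map_mul, mul_inv_rev, Subgroup.coe_mul]
        have := hcomm (k x) (φ₀ y)⁻¹
        simp only [k] at this
        rw [mul_assoc, ← mul_assoc (φ₀ x)⁻¹, ← mul_assoc, this, mul_assoc]
      have hk' : (fun x => (e.symm (k x)).toAdd) ∈ modPCharacters p N := by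
        refine ⟨?_, fun x y => by simp only [hkmul, map_mul, toAdd_mul]⟩
        have h1 : IsLocallyConstant fun x : N => (φ₀ x)⁻¹ * φ x :=
          hφ₀.comp₂ hφ fun s t => s⁻¹ * t
        have h2 : IsLocallyConstant k :=
          IsLocallyConstant.desc k Subtype.val h1 Subtype.val_injective
        exact h2.comp fun m => (e.symm m).toAdd
      have heq : (fun x => (e.symm (k x)).toAdd) - χ = 0 := by
        refine hX1 _ (sub_mem hk' hχ) fun x hx => ?_
        rw [Pi.sub_apply, hχX ⟨x, hx⟩]
        simp only [k, hφf ⟨x, hx⟩, sub_self]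
      ext x
      have hx := congrFun heq x
      rw [Pi.sub_apply, Pi.zero_apply, sub_eq_zero] at hx
      rw [hφk, MonoidHom.mk'_apply, ← hx]
      simp

end Extension

section Gluing

variable {H : Type*} [Group H] [TopologicalSpace H] [IsTopologicalGroup H] [CompactSpace H]
  [TotallyDisconnectedSpace H]

theorem eq_of_forall_openNormalSubgroup_mk_eq {x y : H}
    (h : ∀ U : OpenNormalSubgroup H, (x : H ⧸ U.toSubgroup) = y) : x = y := by
  by_contra hne
  have h1 : (1 : H) ∈ ({x⁻¹ * y}ᶜ : Set H) := fun h => hne (inv_mul_eq_one.1 h.symm)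
  obtain ⟨U, hU⟩ := ProfiniteGrp.exist_openNormalSubgroup_sub_open_nhds_of_one
    isOpen_compl_singleton h1
  exact hU (QuotientGroup.eq.1 (h U)) rfl

/-- A compatible family of continuous homomorphisms to the finite quotients of a profinite group
comes from a continuous homomorphism. -/
theorem exists_continuousMonoidHom_mk_eq {N : Type*} [Group N] [TopologicalSpace N]
    (φ : ∀ U : OpenNormalSubgroup H, N →* H ⧸ U.toSubgroup) (hφ : ∀ U, IsLocallyConstant (φ U))
    (hcompat : ∀ U U' : OpenNormalSubgroup H, U ≤ U' → ∀ (n : N) (h : H),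
      (h : H ⧸ U.toSubgroup) = φ U n → (h : H ⧸ U'.toSubgroup) = φ U' n) :
    ∃ Φ : N →ₜ* H, ∀ U n, (Φ n : H ⧸ U.toSubgroup) = φ U n := by
  have hex : ∀ n, ∃ h : H, ∀ U : OpenNormalSubgroup H, (h : H ⧸ U.toSubgroup) = φ U n := by
    intro n
    -- A directed family of nonempty compact cosets has a common point.
    let S : OpenNormalSubgroup H → Set H := fun U => {h | (h : H ⧸ U.toSubgroup) = φ U n}
    have hne : (⋂ U, S U).Nonempty := by
      have hcl : ∀ U, IsClosed (S U) := by
        intro U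
        have := QuotientGroup.discreteTopology (N := U.toSubgroup) U.isOpen'
        exact (isClosed_discrete {φ U n}).preimage QuotientGroup.continuous_mk
      have : Nonempty (OpenNormalSubgroup H) :=
        ⟨(ProfiniteGrp.exist_openNormalSubgroup_sub_open_nhds_of_one isOpen_univ
          (Set.mem_univ (1 : H))).choose⟩
      refine IsCompact.nonempty_iInter_of_directed_nonempty_isCompact_isClosed S
        (fun U U' => ⟨U ⊓ U', fun h hh => hcompat _ _ inf_le_left n h hh,
          fun h hh => hcompat _ _ inf_le_right n h hh⟩)
        (fun U => ?_) (fun U => (hcl U).isCompact) hcl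
      obtain ⟨h, hh⟩ := QuotientGroup.mk_surjective (φ U n)
      exact ⟨h, hh⟩
    obtain ⟨h, hh⟩ := hne
    exact ⟨h, fun U => Set.mem_iInter.1 hh U⟩
  choose Φ hΦ using hex
  refine ⟨⟨MonoidHom.mk' Φ fun a b => eq_of_forall_openNormalSubgroup_mk_eq fun U => ?_, ?_⟩,
    fun U n => hΦ n U⟩
  · rw [hΦ, map_mul, QuotientGroup.mk_mul, hΦ, hΦ]
  · rw [continuous_iff_continuousAt]
    intro n
    change Filter.Tendsto Φ _ (nhds (Φ n))
    rw [← map_mul_left_nhds_one (Φ n), Filter.tendsto_def]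
    intro O hO
    obtain ⟨O', hO', hO'o, h1⟩ := mem_nhds_iff.1 (Filter.mem_map.1 hO)
    obtain ⟨U, hU⟩ := ProfiniteGrp.exist_openNormalSubgroup_sub_open_nhds_of_one hO'o h1
    filter_upwards [((hφ U).isOpen_fiber (φ U n)).mem_nhds rfl] with m hm
    have hm' : φ U m = φ U n := hm
    rw [← hΦ, ← hΦ, eq_comm, QuotientGroup.eq] at hm'
    have := hO' (hU hm')
    simpa using this

end Gluing

/-- A first countable pro-`p` group with the lifting property for central extensions of finite
`p`-groups is free. -/
theorem IsProPGroup.isFreeProPGroup_of_hasCentralLifting {p : ℕ} [Fact p.Prime] {N : Type u}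
    [Group N] [TopologicalSpace N] [FirstCountableTopology N] (hN : IsProPGroup p N)
    (hlift : HasCentralLifting p N) : IsFreeProPGroup p N := by
  have := hN.isTopologicalGroup
  have := hN.compactSpace
  have := hN.totallyDisconnectedSpace
  obtain ⟨X, hXc, h1X, hX1, hX2⟩ := exists_isClosed_modPCharacters_bijective (p := p) (N := N)
  refine ⟨X, inferInstance, ⟨1, h1X⟩, Subtype.val,
    isCompact_iff_compactSpace.1 hXc.isCompact, inferInstance, inferInstance, hN,
    continuous_subtype_val, rfl, ?_⟩
  intro H _ _ hH f hf hf1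
  have := hH.isTopologicalGroup
  have := hH.compactSpace
  have := hH.totallyDisconnectedSpace
  have hmk : ∀ U : OpenNormalSubgroup H, ∀ {Y : Type u} [TopologicalSpace Y] {g : Y → H},
      Continuous g → IsLocallyConstant fun y => (g y : H ⧸ U.toSubgroup) := by
    intro U Y _ g hg
    have := QuotientGroup.discreteTopology (N := U.toSubgroup) U.isOpen'
    exact (IsLocallyConstant.iff_continuous _).2 (QuotientGroup.continuous_mk.comp hg)
  have hfin : ∀ U : OpenNormalSubgroup H, Finite (H ⧸ U.toSubgroup) := fun U =>
    U.toSubgroup.quotient_finite_of_isOpen U.isOpen'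
  have hpg : ∀ U : OpenNormalSubgroup H, IsPGroup p (H ⧸ U.toSubgroup) := by
    intro U
    obtain ⟨k, hk⟩ := hH.index_eq U.toSubgroup inferInstance U.isOpen'
    exact IsPGroup.of_card hk
  have hex := fun U : OpenNormalSubgroup H => hlift.existsUnique_extension hX1 hX2 _
    (H ⧸ U.toSubgroup) (hpg U) rfl (fun x => (f x : H ⧸ U.toSubgroup)) (hmk U hf) (by
      intro x hx
      have : x = ⟨1, h1X⟩ := Subtype.ext hx
      rw [this, hf1]
      rfl)
  choose φ hφ hφu using hex
  obtain ⟨Φ, hΦ⟩ := exists_continuousMonoidHom_mk_eq φ (fun U => (hφ U).1) (by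
    intro U U' hUU' n h hh
    let r : H ⧸ U.toSubgroup →* H ⧸ U'.toSubgroup :=
      QuotientGroup.map U.toSubgroup U'.toSubgroup (MonoidHom.id H) hUU'
    -- Compatibility of the finite-level extensions comes from their uniqueness.
    have hr : r.comp (φ U) = φ U' := hφu U' _ ⟨(hφ U).1.comp r, fun x => by
      rw [MonoidHom.comp_apply, (hφ U).2]; rfl⟩
    rw [← hr, MonoidHom.comp_apply, ← hh]
    rfl)
  refine ⟨Φ, fun x => eq_of_forall_openNormalSubgroup_mk_eq fun U => ?_, fun Φ' hΦ' => ?_⟩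
  · rw [hΦ, (hφ U).2]
  · ext n
    refine eq_of_forall_openNormalSubgroup_mk_eq fun U => ?_
    rw [hΦ, ← hφu U ((QuotientGroup.mk' U.toSubgroup).comp (Φ' : N →* H))
      ⟨hmk U Φ'.continuous_toFun, fun x => congrArg _ (hΦ' x)⟩]
    rfl

/-! ### Pro-p completions. -/

theorem IsPGroup.pi_of_finite {p : ℕ} {ι : Type*} [Finite ι] {D : ι → Type*}
    [∀ i, Group (D i)] (h : ∀ i, IsPGroup p (D i)) : IsPGroup p (∀ i, D i) := by
  intro x
  choose k hk using fun i => h i (x i)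
  have := Fintype.ofFinite ι
  refine ⟨∑ i, k i, funext fun i => ?_⟩
  obtain ⟨c, hc⟩ := pow_dvd_pow p (Finset.single_le_sum (fun j _ => Nat.zero_le (k j))
    (Finset.mem_univ i))
  rw [Pi.pow_apply, hc, pow_mul, hk, one_pow, Pi.one_apply]

/-- Open normal subgroups of a compact group that is residually a finite `p`-group have `p`-power
index. -/
theorem exists_index_eq_pow_of_jointly_injective {p : ℕ} [Fact p.Prime] {K : Type*} [Group K]
    [TopologicalSpace K] [IsTopologicalGroup K] [CompactSpace K] {ι : Type*} {D : ι → Type*}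
    [∀ i, Group (D i)] (hD : ∀ i, IsPGroup p (D i)) (j : ∀ i, K →* D i)
    (hj : ∀ i, IsLocallyConstant (j i)) (hinj : ∀ x, (∀ i, j i x = 1) → x = 1)
    (U : Subgroup K) (hU : U.Normal) (hUo : IsOpen (U : Set K)) : ∃ k : ℕ, U.index = p ^ k := by
  -- By compactness finitely many of the kernels already intersect inside `U`, so `K ⧸ U` inherits
  -- p-power torsion from a finite product of p-groups.
  obtain ⟨J, hJ⟩ := (hUo.isClosed_compl.isCompact).elim_finite_subfamily_closed
    (fun i => j i ⁻¹' {1}) (fun i => (hj i).isClosed_fiber 1) (by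
      rw [Set.eq_empty_iff_forall_notMem]
      rintro x ⟨hxU, hx⟩
      refine hxU ?_
      rw [hinj x fun i => Set.mem_iInter.1 hx i]
      exact U.one_mem)
  have hfin : Finite (K ⧸ U) := U.quotient_finite_of_isOpen hUo
  have hp : IsPGroup p (K ⧸ U) := by
    intro x
    obtain ⟨x, rfl⟩ := QuotientGroup.mk_surjective x
    obtain ⟨k, hk⟩ := IsPGroup.pi_of_finite (fun i : J => hD i) fun i => j i x
    refine ⟨k, ?_⟩
    rw [← QuotientGroup.mk_pow, QuotientGroup.eq_one_iff]
    by_contra hx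
    refine (Set.eq_empty_iff_forall_notMem.1 hJ (x ^ p ^ k)) ⟨hx, Set.mem_iInter₂.2 fun i hi => ?_⟩
    have := congrFun hk ⟨i, hi⟩
    simpa using this
  exact IsPGroup.iff_card.1 hp

namespace PPowerIndexNormalSubgroup

theorem isPGroup_quot {p : ℕ} {A : Type u} [Group A] (N : PPowerIndexNormalSubgroup p A) :
    IsPGroup p N.Quot := by
  obtain ⟨k, hk⟩ := N.index_eq
  exact IsPGroup.of_card (n := k) hk

variable {p : ℕ} [Fact p.Prime] {A : Type u} [Group A]

instance (N : PPowerIndexNormalSubgroup p A) : Finite N.Quot := by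
  obtain ⟨k, hk⟩ := N.index_eq
  have : N.toSubgroup.FiniteIndex :=
    ⟨by rw [hk]; exact pow_ne_zero _ (Fact.out : p.Prime).ne_zero⟩
  exact inferInstanceAs (Finite (A ⧸ N.toSubgroup))

/-- The kernel of a homomorphism to a finite `p`-group. -/
def ofHom {P : Type*} [Group P] [Finite P] (hP : IsPGroup p P) (f : A →* P) :
    PPowerIndexNormalSubgroup p A where
  toSubgroup := f.ker
  normal := inferInstance
  index_eq := by
    rw [Subgroup.index_ker]
    exact IsPGroup.iff_card.1 (hP.to_subgroup f.range)

end PPowerIndexNormalSubgroup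

namespace ProPCompletion

variable {p : ℕ} {A : Type u} [Group A]

/-- The canonical homomorphism to the pro-`p` completion. -/
def eta (p : ℕ) (A : Type u) [Group A] : A →* ProPCompletion p A where
  toFun a := ⟨fun N => (QuotientGroup.mk' N.toSubgroup a : A ⧸ N.toSubgroup),
    fun _ _ _ => rfl⟩
  map_one' := rfl
  map_mul' _ _ := rfl

/-- The projection of the pro-`p` completion to a finite quotient. -/
def proj (N : PPowerIndexNormalSubgroup p A) : ProPCompletion p A →* N.Quot where
  toFun x := x.1 N
  map_one' := rfl
  map_mul' _ _ := rfl

theorem isLocallyConstant_proj (N : PPowerIndexNormalSubgroup p A) :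
    IsLocallyConstant (proj N) :=
  (IsLocallyConstant.iff_continuous _).2 ((continuous_apply N).comp continuous_subtype_val)

theorem eq_one_of_proj {x : ProPCompletion p A} (h : ∀ N, proj N x = 1) : x = 1 :=
  Subtype.ext (funext h)

theorem isClosed_proPCompletionSubgroup :
    IsClosed (proPCompletionSubgroup p A : Set (∀ N : PPowerIndexNormalSubgroup p A, N.Quot)) := by
  have : (proPCompletionSubgroup p A : Set (∀ N : PPowerIndexNormalSubgroup p A, N.Quot)) =
      ⋂ (M : PPowerIndexNormalSubgroup p A) (N : PPowerIndexNormalSubgroup p A)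
        (h : M.toSubgroup ≤ N.toSubgroup), {x | PPowerIndexNormalSubgroup.map h (x M) = x N} := by
    ext x
    simp only [Set.mem_iInter]
    rfl
  rw [this]
  refine isClosed_iInter fun M => isClosed_iInter fun N => isClosed_iInter fun h => ?_
  exact isClosed_eq (continuous_of_discreteTopology.comp (continuous_apply M)) (continuous_apply N)

variable [Fact p.Prime]

instance : CompactSpace (ProPCompletion p A) :=
  isCompact_iff_compactSpace.1 isClosed_proPCompletionSubgroup.isCompact

theorem isProPGroup_subgroup (K : Subgroup (ProPCompletion p A))
    (hK : IsClosed (K : Set (ProPCompletion p A))) : IsProPGroup p K where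
  isTopologicalGroup := inferInstance
  compactSpace := isCompact_iff_compactSpace.1 hK.isCompact
  totallyDisconnectedSpace := inferInstance
  index_eq := by
    have : CompactSpace K := isCompact_iff_compactSpace.1 hK.isCompact
    exact exists_index_eq_pow_of_jointly_injective
      (fun N : PPowerIndexNormalSubgroup p A => N.isPGroup_quot)
      (fun N => (proj N).comp K.subtype)
      (fun N => (isLocallyConstant_proj N).comp_continuous continuous_subtype_val)
      fun x hx => Subtype.ext (eq_one_of_proj hx)

theorem index_eq_of_isOpen (U : Subgroup (ProPCompletion p A)) (hU : U.Normal)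
    (hUo : IsOpen (U : Set (ProPCompletion p A))) : ∃ k : ℕ, U.index = p ^ k :=
  exists_index_eq_pow_of_jointly_injective
    (fun N : PPowerIndexNormalSubgroup p A => N.isPGroup_quot) proj isLocallyConstant_proj
    (fun _ hx => eq_one_of_proj hx) U hU hUo

theorem denseRange_eta : DenseRange (eta p A) := by
  intro x
  rw [mem_closure_iff_nhds]
  intro O hO
  rw [nhds_subtype_eq_comap, nhds_pi, Filter.mem_comap] at hO
  obtain ⟨O', hO', hOO'⟩ := hO
  obtain ⟨J, hJ, t, ht, htO⟩ := Filter.mem_pi.1 hO'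
  have := hJ.to_subtype
  let f : A →* ∀ N : J, N.1.Quot :=
    { toFun := fun a N => (QuotientGroup.mk' N.1.toSubgroup a : A ⧸ N.1.toSubgroup)
      map_one' := rfl
      map_mul' := fun _ _ => rfl }
  -- A basic neighbourhood constrains finitely many coordinates, and the single coordinate at their
  -- intersection `M` determines all of them.
  let M := PPowerIndexNormalSubgroup.ofHom
    (IsPGroup.pi_of_finite fun N : J => N.1.isPGroup_quot) f
  obtain ⟨a, ha⟩ := QuotientGroup.mk_surjective (s := M.toSubgroup) (x.1 M)
  refine ⟨eta p A a, hOO' (htO fun N hN => ?_), a, rfl⟩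
  have hMN : M.toSubgroup ≤ N.toSubgroup := fun b hb =>
    (QuotientGroup.eq_one_iff b).1 (congrFun (MonoidHom.mem_ker.1 hb) ⟨N, hN⟩)
  have hxN : (eta p A a).1 N = x.1 N := by
    rw [← x.2 M N hMN]
    exact congrArg (PPowerIndexNormalSubgroup.map hMN) ha
  rw [hxN]
  exact mem_of_mem_nhds (ht N)

/-- Homomorphisms to finite `p`-groups extend to the pro-`p` completion. -/
theorem exists_extension {P : Type*} [Group P] [Finite P] (hP : IsPGroup p P) (f : A →* P) :
    ∃ Φ : ProPCompletion p A →* P, IsLocallyConstant Φ ∧ ∀ a, Φ (eta p A a) = f a := by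
  let N := PPowerIndexNormalSubgroup.ofHom hP f
  let r : N.Quot →* P := QuotientGroup.kerLift f
  exact ⟨r.comp (proj N), (isLocallyConstant_proj N).comp r, fun a => rfl⟩

theorem eq_of_forall_eta {α : Type*} {f g : ProPCompletion p A → α} (hf : IsLocallyConstant f)
    (hg : IsLocallyConstant g) (h : ∀ a, f (eta p A a) = g (eta p A a)) : f = g := by
  let _ : TopologicalSpace α := ⊥
  have : DiscreteTopology α := ⟨rfl⟩
  exact denseRange_eta.equalizer hf.continuous hg.continuous (funext h)

end ProPCompletion

/-- Each such subgroup is the kernel of the permutation action on its finite quotient, and a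
finitely generated group has finitely many homomorphisms to each finite symmetric group. This makes
the completion first countable. -/
theorem countable_pPowerIndexNormalSubgroup (p : ℕ) [Fact p.Prime] (A : Type u) [Group A]
    [Group.FG A] : Countable (PPowerIndexNormalSubgroup p A) := by
  obtain ⟨S, hS⟩ := (Group.fg_def (G := A)).1 inferInstance
  have hhom : ∀ n : ℕ, Finite (A →* Equiv.Perm (Fin n)) := fun n =>
    Finite.of_injective (fun f => fun s : S => f s) fun f g h =>
      MonoidHom.eq_of_eqOn_dense hS fun s hs => congrFun h ⟨s, hs⟩
  have hex : ∀ N : PPowerIndexNormalSubgroup p A,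
      ∃ f : Σ n : ℕ, A →* Equiv.Perm (Fin n), f.2.ker = N.toSubgroup := by
    intro N
    let e : (A ⧸ N.toSubgroup) ≃ Fin (Nat.card N.Quot) := Finite.equivFin N.Quot
    let φ : A →* Equiv.Perm (Fin (Nat.card N.Quot)) :=
      (e.permCongrHom.toMonoidHom.comp
        (MulAction.toPermHom (A ⧸ N.toSubgroup) (A ⧸ N.toSubgroup))).comp
        (QuotientGroup.mk' N.toSubgroup)
    refine ⟨⟨_, φ⟩, ?_⟩
    have hinj : Function.Injective (e.permCongrHom.toMonoidHom.comp
        (MulAction.toPermHom (A ⧸ N.toSubgroup) (A ⧸ N.toSubgroup))) :=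
      e.permCongrHom.injective.comp MulAction.toPerm_injective
    rw [← MonoidHom.comap_ker, (MonoidHom.ker_eq_bot_iff _).2 hinj]
    exact QuotientGroup.ker_mk' _
  choose F hF using hex
  refine Function.Injective.countable (f := F) fun M N h => ?_
  have : M.toSubgroup = N.toSubgroup := by rw [← hF, ← hF, h]
  cases M; cases N; cases this; rfl

/-! ### Right-angled Artin groups. -/

theorem RightAngledArtinGroup.eq_of_eq_of {V : Type u} {Γ : SimpleGraph V} {P : Type*} [Group P]
    {f g : RightAngledArtinGroup Γ →* P}
    (h : ∀ v, f (PresentedGroup.of v) = g (PresentedGroup.of v)) : f = g :=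
  PresentedGroup.ext h

theorem RightAngledArtinGroup.exists_hom {V : Type u} {Γ : SimpleGraph V} {P : Type*} [Group P]
    (w : V → P) (hw : ∀ a b, Γ.Adj a b → w a * w b = w b * w a) :
    ∃ f : RightAngledArtinGroup Γ →* P, ∀ v, f (PresentedGroup.of v) = w v := by
  refine ⟨PresentedGroup.toGroup (f := w) ?_, fun v => PresentedGroup.toGroup.of _⟩
  rintro r ⟨a, b, hab, rfl⟩
  simp [hw a b hab]

theorem RightAngledArtinGroup.of_mul_of {V : Type u} {Γ : SimpleGraph V} {a b : V}
    (h : Γ.Adj a b) : (PresentedGroup.of a * PresentedGroup.of b : RightAngledArtinGroup Γ) =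
      PresentedGroup.of b * PresentedGroup.of a := by
  have : (PresentedGroup.of a * PresentedGroup.of b * (PresentedGroup.of a)⁻¹ *
      (PresentedGroup.of b)⁻¹ : RightAngledArtinGroup Γ) = 1 :=
    PresentedGroup.one_of_mem ⟨a, b, h, rfl⟩
  rwa [mul_inv_eq_one, mul_inv_eq_iff_eq_mul] at this

instance {V : Type u} [Finite V] (Γ : SimpleGraph V) : Group.FG (RightAngledArtinGroup Γ) :=
  Group.fg_iff.2 ⟨_, PresentedGroup.closure_range_of _, Set.finite_range _⟩

instance {p : ℕ} [Fact p.Prime] {V : Type u} [Finite V] (Γ : SimpleGraph V) :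
    FirstCountableTopology (RightAngledArtinProPGroup p Γ) := by
  have := countable_pPowerIndexNormalSubgroup p (RightAngledArtinGroup Γ)
  have : FirstCountableTopology
      (∀ N : PPowerIndexNormalSubgroup p (RightAngledArtinGroup Γ), N.Quot) := inferInstance
  exact Topology.IsInducing.subtypeVal.firstCountableTopology

/-! ### Wreath products and the Kaloujnine–Krasner construction. -/

namespace RegularWreathProduct

theorem isPGroup {p : ℕ} [Fact p.Prime] {D Q : Type*} [Group D] [Group Q] [Finite D] [Finite Q]
    (hD : IsPGroup p D) (hQ : IsPGroup p Q) : IsPGroup p (RegularWreathProduct D Q) := by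
  obtain ⟨a, ha⟩ := IsPGroup.iff_card.1 hD
  obtain ⟨b, hb⟩ := IsPGroup.iff_card.1 hQ
  refine IsPGroup.of_card (n := a * Nat.card Q + b) ?_
  rw [card, ha, hb, pow_add, pow_mul]

/-- Functoriality of the regular wreath product in the base group. -/
def mapLeft {D D' : Type*} (Q : Type*) [Group D] [Group D'] [Group Q] (f : D →* D') :
    RegularWreathProduct D Q →* RegularWreathProduct D' Q where
  toFun x := ⟨fun q => f (x.left q), x.right⟩
  map_one' := by ext <;> simp
  map_mul' x y := by ext <;> simp

/-- The Kaloujnine–Krasner homomorphism, induced along a homomorphism `ψ` of the commutator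
subgroup, with respect to a section `s` of the abelianization and pulled back to `Q`. -/
noncomputable def ofCommutator {G B P Q : Type*} [Group G] [Group B] [Group P] [Group Q]
    (ψ : commutator B →* P) (β : G →* B) (ρ : G →* Q) (τ : Q →* Abelianization B)
    (h : ∀ g, τ (ρ g) = Abelianization.of (β g)) (s : Abelianization B → B)
    (hs : ∀ q, Abelianization.of (s q) = q) : G →* RegularWreathProduct P Q :=
  have hmem : ∀ g x, (s (τ x))⁻¹ * β g * s (τ ((ρ g)⁻¹ * x)) ∈ commutator B := fun g x => by
    rw [← Abelianization.ker_of, MonoidHom.mem_ker]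
    simp only [map_mul, map_inv, hs, h]
    rw [mul_assoc, mul_inv_cancel_left, inv_mul_cancel]
  MonoidHom.mk' (fun g => ⟨fun x => ψ ⟨_, hmem g x⟩, ρ g⟩) fun g g' => by
    ext x
    · simp only [mul_left, Pi.mul_apply, ← map_mul ψ]
      congr 1
      apply Subtype.ext
      simp only [map_mul, mul_inv_rev, Subgroup.coe_mul, mul_assoc, mul_inv_cancel_left]
    · simp

theorem ofCommutator_left {G B P Q : Type*} [Group G] [Group B] [Group P] [Group Q]
    (ψ : commutator B →* P) (β : G →* B) (ρ : G →* Q) (τ : Q →* Abelianization B)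
    (h : ∀ g, τ (ρ g) = Abelianization.of (β g)) (s : Abelianization B → B)
    (hs : ∀ q, Abelianization.of (s q) = q) (g : G) (x : Q) (c : commutator B)
    (hc : (c : B) = (s (τ x))⁻¹ * β g * s (τ ((ρ g)⁻¹ * x))) :
    (ofCommutator ψ β ρ τ h s hs g).left x = ψ c :=
  congrArg ψ (Subtype.ext hc.symm)

theorem ofCommutator_right {G B P Q : Type*} [Group G] [Group B] [Group P] [Group Q]
    (ψ : commutator B →* P) (β : G →* B) (ρ : G →* Q) (τ : Q →* Abelianization B)
    (h : ∀ g, τ (ρ g) = Abelianization.of (β g)) (s : Abelianization B → B)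
    (hs : ∀ q, Abelianization.of (s q) = q) (g : G) :
    (ofCommutator ψ β ρ τ h s hs g).right = ρ g := rfl

/-- The coordinates see `g` and `x` only through `B` and its abelianization. This gives periodicity
over ℤ^V, and it compares the construction on the discrete group over ℤ^V with that on its
completion over a finite quotient of ℤ^V. -/
theorem ofCommutator_congr {G G' B P Q Q' : Type*} [Group G] [Group G'] [Group B] [Group P]
    [Group Q] [Group Q'] (ψ : commutator B →* P) {β : G →* B} {β' : G' →* B} {ρ : G →* Q}
    {ρ' : G' →* Q'} {τ : Q →* Abelianization B} {τ' : Q' →* Abelianization B}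
    (h : ∀ g, τ (ρ g) = Abelianization.of (β g)) (h' : ∀ g, τ' (ρ' g) = Abelianization.of (β' g))
    (s : Abelianization B → B) (hs : ∀ q, Abelianization.of (s q) = q) {g : G} {g' : G'}
    (hg : β g = β' g') {x : Q} {x' : Q'} (hx : τ x = τ' x')  :
    (ofCommutator ψ β ρ τ h s hs g).left x = (ofCommutator ψ β' ρ' τ' h' s hs g').left x' := by
  refine congrArg ψ (Subtype.ext ?_)
  simp only [map_mul, map_inv, h, h', hx, hg]

end RegularWreathProduct

/-! ### The closed commutator subgroup and finite quotients. -/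

section Commutator

variable {G : Type*} [Group G] [TopologicalSpace G] [IsTopologicalGroup G]

theorem topologicalClosure_commutator_le_ker {C : Type*} [CommGroup C] (f : G →* C)
    (hf : IsLocallyConstant f) : (commutator G).topologicalClosure ≤ f.ker :=
  Subgroup.topologicalClosure_minimal _ (Abelianization.commutator_subset_ker f)
    (hf.isClosed_fiber 1)

theorem map_mem_commutator_of_mem_topologicalClosure {B : Type*} [Group B] (f : G →* B)
    (hf : IsLocallyConstant f) {x : G} (hx : x ∈ (commutator G).topologicalClosure) :
    f x ∈ commutator B := by
  have := topologicalClosure_commutator_le_ker (Abelianization.of.comp f)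
    (hf.comp Abelianization.of) hx
  rwa [← Abelianization.ker_of]

/-- A continuous homomorphism from the closed commutator subgroup to a discrete group factors
through the commutator subgroup of a finite quotient. -/
theorem exists_factor_through_commutator [CompactSpace G] [TotallyDisconnectedSpace G]
    {P : Type*} [Group P] (φ : (commutator G).topologicalClosure →* P)
    (hφ : IsLocallyConstant φ) :
    ∃ (W : OpenNormalSubgroup G) (ψ : commutator (G ⧸ W.toSubgroup) →* P),
      ∀ (n : (commutator G).topologicalClosure) (c : commutator (G ⧸ W.toSubgroup)),
        (c : G ⧸ W.toSubgroup) = ((n : G) : G ⧸ W.toSubgroup) → ψ c = φ n := by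
  obtain ⟨O, hO, hOφ⟩ := isOpen_induced_iff.1 (hφ.isOpen_fiber 1)
  have h1O : (1 : G) ∈ O := by
    have : (1 : (commutator G).topologicalClosure) ∈ Subtype.val ⁻¹' O := by
      rw [hOφ]; exact map_one φ
    exact this
  obtain ⟨W, hW⟩ := ProfiniteGrp.exist_openNormalSubgroup_sub_open_nhds_of_one hO h1O
  have := QuotientGroup.discreteTopology (N := W.toSubgroup) W.isOpen'
  let β : G →* G ⧸ W.toSubgroup := QuotientGroup.mk' W.toSubgroup
  have hβ : IsLocallyConstant β := (IsLocallyConstant.iff_continuous _).2 QuotientGroup.continuous_mk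
  let r : (commutator G).topologicalClosure →* commutator (G ⧸ W.toSubgroup) :=
    (β.comp (Subgroup.subtype _)).codRestrict _ fun n =>
      map_mem_commutator_of_mem_topologicalClosure β hβ n.2
  -- The abstract commutator subgroup of `G` already maps onto that of the quotient.
  have hr : Function.Surjective r := by
    rintro ⟨c, hc⟩
    have hmap : (commutator G).map β = commutator (G ⧸ W.toSubgroup) := by
      rw [commutator_def, Subgroup.map_commutator, ← MonoidHom.range_eq_map,
        MonoidHom.range_eq_top.2 (QuotientGroup.mk'_surjective _), ← commutator_def]
    rw [← hmap] at hc
    obtain ⟨g, hg, rfl⟩ := hc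
    exact ⟨⟨g, Subgroup.le_topologicalClosure _ hg⟩, rfl⟩
  have hker : r.ker ≤ φ.ker := by
    intro n hn
    have h1 : (n : G) ∈ W.toSubgroup :=
      (QuotientGroup.eq_one_iff _).1 (congrArg Subtype.val (MonoidHom.mem_ker.1 hn))
    have h2 : n ∈ Subtype.val ⁻¹' O := hW h1
    rw [hOφ] at h2
    exact h2
  refine ⟨W, r.liftOfSurjective hr ⟨φ, hker⟩, fun n c hc => ?_⟩
  obtain rfl : r n = c := Subtype.ext hc.symm
  exact MonoidHom.liftOfRightInverse_comp_apply r _ (Function.rightInverse_surjInv hr) ⟨φ, hker⟩ n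

end Commutator

/-! ### The lifting property and the conclusion. -/

/-- The closed commutator subgroup of the right-angled Artin pro-`p` group of a chordal graph has
the lifting property for central extensions of finite `p`-groups. -/
theorem SimpleGraph.IsChordalGraph.hasCentralLifting {p : ℕ} [Fact p.Prime] {V : Type u} [Finite V]
    {Γ : SimpleGraph V} (hΓ : Γ.IsChordalGraph) :
    HasCentralLifting p (commutator (RightAngledArtinProPGroup p Γ)).topologicalClosure := by
  classical
  intro E P _ _ _ hE π hπ hc hexp φ hφ
  have := Fintype.ofFinite V
  have hp : 0 < p := (Fact.out : p.Prime).pos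
  let A := RightAngledArtinGroup Γ
  let G := RightAngledArtinProPGroup p Γ
  let η : A →* G := ProPCompletion.eta p A
  obtain ⟨W, ψ, hψ⟩ := exists_factor_through_commutator φ hφ
  let B := G ⧸ W.toSubgroup
  let β : G →* B := QuotientGroup.mk' W.toSubgroup
  have hβ : IsLocallyConstant β := by
    have := QuotientGroup.discreteTopology (N := W.toSubgroup) W.isOpen'
    exact (IsLocallyConstant.iff_continuous _).2 QuotientGroup.continuous_mk
  have : Finite B := W.toSubgroup.quotient_finite_of_isOpen W.isOpen'
  have hB : IsPGroup p (Abelianization B) := by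
    obtain ⟨k, hk⟩ := ProPCompletion.index_eq_of_isOpen W.toSubgroup inferInstance W.isOpen'
    exact (IsPGroup.of_card hk : IsPGroup p B).to_quotient _
  let b : V → B := fun v => β (η (PresentedGroup.of v))
  -- The section is normalised at 1 so that the coordinate at 1 of an element of the commutator
  -- subgroup is exactly its image under `ψ`.
  let s : Abelianization B → B := fun q =>
    if q = 1 then 1 else Function.surjInv (QuotientGroup.mk_surjective (s := commutator B)) q
  have hs1 : s 1 = 1 := if_pos rfl
  have hs : ∀ q, Abelianization.of (s q) = q := by
    intro q
    by_cases hq : q = 1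
    · rw [hq, hs1, map_one]
    · simp only [s, if_neg hq]
      exact Function.surjInv_eq _ q
  let T : Multiplicative (V → ℤ) →* Abelianization B :=
    MonoidHom.mk' (fun x => ∏ v, Abelianization.of (b v) ^ (-(x.toAdd v))) fun x y => by
      rw [← Finset.prod_mul_distrib]
      refine Finset.prod_congr rfl fun v _ => ?_
      rw [toAdd_mul, Pi.add_apply, neg_add, zpow_add]
  -- Multiplication in the wreath product translates by the inverse of the right component; the sign
  -- turns this into the shift x ↦ x + e_v.
  let q : V → Multiplicative (V → ℤ) := fun v => Multiplicative.ofAdd (-Pi.single v 1)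
  have hTq : ∀ v, T (q v) = Abelianization.of (b v) := by
    intro v
    simp only [T, q, MonoidHom.mk'_apply, toAdd_ofAdd, Pi.neg_apply, neg_neg]
    rw [Finset.prod_eq_single v]
    · simp
    · intro w _ hw
      simp [hw]
    · simp
  have hqmul : ∀ v (x : Multiplicative (V → ℤ)),
      (q v)⁻¹ * x = Multiplicative.ofAdd (x.toAdd + Pi.single v 1) := by
    intro v x
    simp only [q, ← ofAdd_neg, neg_neg]
    rw [add_comm]
    rfl
  obtain ⟨k, hk⟩ : ∃ k : ℕ, ∀ c : Abelianization B, c ^ p ^ k = 1 := by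
    obtain ⟨k, hk⟩ := IsPGroup.iff_card.1 hB
    exact ⟨k, fun c => hk ▸ pow_card_eq_one'⟩
  have hTper : ∀ x y : V → ℤ, (∀ v, x v ≡ y v [ZMOD (p : ℤ) ^ k]) →
      T (Multiplicative.ofAdd x) = T (Multiplicative.ofAdd y) := by
    intro x y h
    refine Finset.prod_congr rfl fun v _ => ?_
    refine zpow_eq_zpow_iff_modEq.2 ((h v).neg.of_dvd ?_)
    exact_mod_cast orderOf_dvd_of_pow_eq_one (hk _)
  obtain ⟨ρA, hρA⟩ := RightAngledArtinGroup.exists_hom (Γ := Γ) q fun _ _ _ => mul_comm _ _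
  have hTρ : ∀ a, T (ρA a) = Abelianization.of ((β.comp η) a) := fun a =>
    DFunLike.congr_fun (RightAngledArtinGroup.eq_of_eq_of (f := T.comp ρA)
      (g := Abelianization.of.comp (β.comp η)) fun v => by
        rw [MonoidHom.comp_apply, hρA, hTq]; rfl) a
  let κ := RegularWreathProduct.ofCommutator ψ (β.comp η) ρA T hTρ s hs
  let f : V → (V → ℤ) → P := fun v x =>
    (κ (PresentedGroup.of v)).left (Multiplicative.ofAdd x)
  have hf : ∀ v, PrimePowPeriodic p (f v) := fun v => ⟨k, fun x y h =>
    RegularWreathProduct.ofCommutator_congr ψ hTρ hTρ s hs rfl (hTper x y h)⟩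
  have hsq : ∀ v w, Γ.Adj v w → ∀ x,
      f v x * f w (x + Pi.single v 1) = f w x * f v (x + Pi.single w 1) := by
    intro v w hvw x
    have h1 := congrArg κ (RightAngledArtinGroup.of_mul_of hvw)
    have h2 := congrFun (congrArg RegularWreathProduct.left h1) (Multiplicative.ofAdd x)
    simp only [map_mul, RegularWreathProduct.mul_left, Pi.mul_apply, κ,
      RegularWreathProduct.ofCommutator_right, hρA, hqmul] at h2
    exact h2
  obtain ⟨F, hFp, hFπ, hFsq⟩ := hΓ.exists_periodic_lift hp π hπ hc hexp f hf hsq Finset.univ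
  -- The lifts may need a larger period than `f`, so the abelianization of `B` is replaced by the
  -- finite p-group (ℤ/p^m)^V, which still maps to it.
  obtain ⟨m, hkm, hm⟩ : ∃ m ≥ k, ∀ v, ∀ x y : V → ℤ, (∀ w, x w ≡ y w [ZMOD (p : ℤ) ^ m]) →
      F v x = F v y := by
    choose M hM using fun v => (hFp v (Finset.mem_univ v)).exists_forall_ge
    refine ⟨k + ∑ v, M v, Nat.le_add_right _ _, fun v => hM v _ ?_⟩
    exact (Finset.single_le_sum (fun w _ => Nat.zero_le (M w)) (Finset.mem_univ v)).trans
      (Nat.le_add_left _ _)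
  have : NeZero (p ^ m) := ⟨pow_ne_zero _ hp.ne'⟩
  let Q := Multiplicative (V → ZMod (p ^ m))
  let red : Multiplicative (V → ℤ) →* Q :=
    MonoidHom.mk' (fun x => Multiplicative.ofAdd fun v => (x.toAdd v : ZMod (p ^ m)))
      fun x y => by
        rw [← ofAdd_add]
        congr 1
        ext v
        simp
  have hred : Function.Surjective red := by
    intro y
    refine ⟨Multiplicative.ofAdd fun v => (y.toAdd v).cast, ?_⟩
    apply Multiplicative.toAdd.injective
    ext v
    exact ZMod.intCast_zmod_cast _
  have hred_eq : ∀ x y : Multiplicative (V → ℤ), red x = red y →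
      ∀ v, x.toAdd v ≡ y.toAdd v [ZMOD (p : ℤ) ^ m] := by
    intro x y h v
    have := congrFun (congrArg Multiplicative.toAdd h) v
    have := (ZMod.intCast_eq_intCast_iff _ _ _).1 this
    exact_mod_cast this
  have hTm : ∀ x y : Multiplicative (V → ℤ), red x = red y → T x = T y := fun x y h =>
    hTper x.toAdd y.toAdd fun v => (hred_eq x y h v).of_dvd (pow_dvd_pow _ hkm)
  have hker : red.ker ≤ T.ker := fun x hx => by
    rw [MonoidHom.mem_ker] at hx ⊢
    rw [hTm x 1 (by rw [hx, map_one]), map_one]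
  let τ : Q →* Abelianization B := red.liftOfSurjective hred ⟨T, hker⟩
  have hτ : ∀ x, τ (red x) = T x := fun x =>
    MonoidHom.liftOfRightInverse_comp_apply red _ (Function.rightInverse_surjInv hred) ⟨T, hker⟩ x
  let F' : V → Q → E := fun v y => F v (Function.surjInv hred y).toAdd
  have hF' : ∀ v x, F' v (red x) = F v x.toAdd := fun v x =>
    hm v _ _ (hred_eq _ x (Function.surjInv_eq hred _))
  let ω : V → RegularWreathProduct E Q := fun v => ⟨F' v, red (q v)⟩
  have hω : ∀ v w, Γ.Adj v w → ω v * ω w = ω w * ω v := by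
    intro v w hvw
    refine RegularWreathProduct.ext (funext fun y => ?_) (mul_comm _ _)
    obtain ⟨x, rfl⟩ := hred y
    simp only [RegularWreathProduct.mul_left, Pi.mul_apply, ω, ← map_inv, ← map_mul, hF', hqmul]
    exact hFsq v (Finset.mem_univ v) w (Finset.mem_univ w) hvw x.toAdd
  have hQ : IsPGroup p Q := IsPGroup.of_card (n := m * Nat.card V) (by
    rw [Nat.card_congr Multiplicative.toAdd, Nat.card_fun, Nat.card_zmod, pow_mul])
  obtain ⟨θ, hθ⟩ := RightAngledArtinGroup.exists_hom ω hω
  obtain ⟨Θ, hΘ, hΘθ⟩ := ProPCompletion.exists_extension (RegularWreathProduct.isPGroup hE hQ) θ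
  have hgen : ∀ {C : Type u} [Group C] (f g : G →* C), IsLocallyConstant f →
      IsLocallyConstant g → (∀ v, f (η (PresentedGroup.of v)) = g (η (PresentedGroup.of v))) →
      ∀ x, f x = g x := by
    intro C _ f g hf hg h
    refine congrFun (ProPCompletion.eq_of_forall_eta hf hg fun a => ?_)
    exact DFunLike.congr_fun
      (RightAngledArtinGroup.eq_of_eq_of (f := f.comp η) (g := g.comp η) h) a
  have hΘω : ∀ v, Θ (η (PresentedGroup.of v)) = ω v := fun v => (hΘθ _).trans (hθ v)
  let ρ : G →* Q := RegularWreathProduct.rightHom.comp Θ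
  have hρ : IsLocallyConstant ρ := hΘ.comp RegularWreathProduct.rightHom
  have hτρ : ∀ g, τ (ρ g) = Abelianization.of (β g) :=
    hgen (τ.comp ρ) (Abelianization.of.comp β) (hρ.comp τ) (hβ.comp Abelianization.of) fun v => by
      change τ (Θ (η (PresentedGroup.of v))).right = _
      rw [hΘω, hτ, hTq]
      rfl
  -- The homomorphism induced from φ on all of `G`. It agrees with the image of `Θ` under `π` on the
  -- generators, hence everywhere by density.
  let Θ' := RegularWreathProduct.ofCommutator ψ β ρ τ hτρ s hs
  have hΘ' : IsLocallyConstant Θ' := by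
    rw [IsLocallyConstant.iff_eventually_eq]
    intro g
    filter_upwards [(IsLocallyConstant.iff_eventually_eq _).1 hβ g,
      (IsLocallyConstant.iff_eventually_eq _).1 hρ g] with g' h1 h2
    exact RegularWreathProduct.ext
      (funext fun x => RegularWreathProduct.ofCommutator_congr ψ hτρ hτρ s hs h1 rfl) h2
  have hΘΘ' : ∀ g, RegularWreathProduct.mapLeft Q π (Θ g) = Θ' g := by
    refine hgen ((RegularWreathProduct.mapLeft Q π).comp Θ) Θ'
      (hΘ.comp (RegularWreathProduct.mapLeft Q π)) hΘ' fun v => ?_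
    refine RegularWreathProduct.ext (funext fun y => ?_) rfl
    obtain ⟨x, rfl⟩ := hred y
    change π ((Θ (η (PresentedGroup.of v))).left (red x)) = _
    rw [hΘω]
    change π (F' v (red x)) = _
    rw [hF', hFπ v (Finset.mem_univ v)]
    exact RegularWreathProduct.ofCommutator_congr ψ hTρ hτρ s hs rfl (hτ x).symm
  have hright : ∀ n ∈ (commutator G).topologicalClosure, (Θ n).right = 1 := fun n hn =>
    topologicalClosure_commutator_le_ker ρ hρ hn
  -- Elements of the closed commutator subgroup have trivial right component, so there evaluation at
  -- 1 is multiplicative.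
  refine ⟨MonoidHom.mk' (fun n => (Θ n).left 1) fun n n' => ?_, ?_, fun n => ?_⟩
  · simp [hright n n.2]
  · exact (hΘ.comp_continuous continuous_subtype_val).comp fun z => z.left 1
  · have h1 : π ((Θ n).left 1) = (Θ' n).left 1 :=
      congrFun (congrArg RegularWreathProduct.left (hΘΘ' n)) 1
    have h2 : ρ n = 1 := hright n n.2
    rw [MonoidHom.mk'_apply, h1]
    have hmem := map_mem_commutator_of_mem_topologicalClosure β hβ n.2
    rw [RegularWreathProduct.ofCommutator_left ψ β ρ τ hτρ s hs n 1 ⟨β n, hmem⟩ (by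
      simp [h2, hs1])]
    exact hψ n _ rfl

/-- For a finite chordal graph `Γ`, the commutator subgroup (the closed subgroup generated by all
commutators) of the right-angled Artin pro-`p` group of `Γ` is a free pro-`p` group. -/
theorem lemma5p1 (p : ℕ) [Fact p.Prime] {V : Type u} [Finite V] (Γ : SimpleGraph V)
    (hΓ : Γ.IsChordalGraph) :
    IsFreeProPGroup p (commutator (RightAngledArtinProPGroup p Γ)).topologicalClosure := by
  have : FirstCountableTopology (commutator (RightAngledArtinProPGroup p Γ)).topologicalClosure :=
    Topology.IsInducing.subtypeVal.firstCountableTopology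
  exact (ProPCompletion.isProPGroup_subgroup _
    (Subgroup.isClosed_topologicalClosure _)).isFreeProPGroup_of_hasCentralLifting
    hΓ.hasCentralLifting
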